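/- **Proposition 2.5.** Let $n\ge 1$, $s\in(0,1)$ and $0<\lambda\le\Lambda$. Let $\Omega\subset\mathbb R^n$ be a bounded $C^{1,\alpha}$ domain with $s<\alpha\le 1$, i.e. a bounded open set which near each of its boundary points is, after a rotation, the open epigraph of a $C^{1,\alpha}$ function. Let $d:\mathbb R^n\to[0,\infty)$ be a fixed function that coincides with $\operatorname{dist}(x,\mathbb R^n\setminus\Omega)$ in a neighbourhood of $\partial\Omega$, satisfies $d\equiv 0$ in $\mathbb R^n\setminus\Omega$ and $d>0$ in $\Omega$, and is $C^{1,\alpha}$ in $\Omega$ (i.e. $d$ is differentiable in $\Omega$ and $|\nabla d(x)-\nabla d(y)|\le K|x-y|^\alpha$ for some constant $K$ and all $x,y\in\Omega$). Then there is a constant $C$, depending only on $n$, $s$, $\lambda$, $\Lambda$, $\Omega$ and the function $d$ fixed for $\Omega$, such that for every measurable $a:S^{n-1}\to\mathbb R$ with $\lambda\le a(\theta)\le\Lambda$ for all $\theta\in S^{n-1}$, the operator $$Lu(x)=\int_{\mathbb R^n}\left(\frac{u(x+y)+u(x-y)}{2}-u(x)\right)\frac{a(y/|y|)}{|y|^{n+2s}}\,dy$$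 satisfies: for every $x\in\Omega$ the integral defining $L(d^s)(x)$ converges absolutely, and $$|L(d^s)(x)|\le C .$$ -/

import Mathlib

open MeasureTheory Metric Set Topology
open scoped InnerProductSpace

/-- The function `f` is `C^{1,α}` in the set `S` (with bounds uniform in `S`): it is differentiable
at every point of `S` and its differential is Hölder continuous of exponent `α` on `S`.
For a bounded `C^{1,α}` domain `S` this amounts to finiteness of the `C^{1,α}(S)` norm. -/
def IsC1Holder {E : Type*} [NormedAddCommGroup E] [NormedSpace ℝ E]
    (α : ℝ) (S : Set E) (f : E → ℝ) : Prop :=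
  (∀ x ∈ S, DifferentiableAt ℝ f x) ∧
    ∃ K : ℝ, ∀ x ∈ S, ∀ y ∈ S, ‖fderiv ℝ f x - fderiv ℝ f y‖ ≤ K * ‖x - y‖ ^ α

/-- `Ω ⊆ ℝⁿ` is a `C^{1,α}` open set: near each boundary point `z` it is, for a suitable unit
vector `e` (the "vertical" direction), the open epigraph of a `C^{1,α}` function `γ` defined on the
hyperplane orthogonal to `e`. -/
def IsC1HolderDomain {n : ℕ} (α : ℝ) (Ω : Set (EuclideanSpace ℝ (Fin n))) : Prop :=
  IsOpen Ω ∧ ∀ z ∈ frontier Ω, ∃ ρ : ℝ, 0 < ρ ∧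
    ∃ e : EuclideanSpace ℝ (Fin n), ‖e‖ = 1 ∧
      ∃ γ : (Submodule.span ℝ {e})ᗮ → ℝ, IsC1Holder α univ γ ∧
        ∀ x ∈ ball z ρ, x ∈ Ω ↔ γ ((Submodule.span ℝ {e})ᗮ.orthogonalProjectionOnto x) < ⟪x, e⟫_ℝ

/-- `d` is a distance function for `Ω`: it coincides with `dist(·, ℝⁿ ∖ Ω)` in a
neighbourhood of `∂Ω`, vanishes identically outside `Ω`, is positive in `Ω`, and is `C^{1,α}` in
`Ω`. -/
structure IsDistanceFunction {n : ℕ} (α : ℝ) (Ω : Set (EuclideanSpace ℝ (Fin n)))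
    (d : EuclideanSpace ℝ (Fin n) → ℝ) : Prop where
  eq_infDist : ∃ U : Set (EuclideanSpace ℝ (Fin n)), IsOpen U ∧ frontier Ω ⊆ U ∧
    ∀ x ∈ U, d x = infDist x Ωᶜ
  eq_zero : ∀ x, x ∉ Ω → d x = 0
  pos : ∀ x ∈ Ω, 0 < d x
  isC1Holder : IsC1Holder α Ω d

/-- The admissible angular densities: measurable functions on the unit sphere with values in
`[lam, Lam]`. Only the values of `a` on the unit sphere matter. -/
def IsEllipticDensity {n : ℕ} (lam Lam : ℝ) (a : EuclideanSpace ℝ (Fin n) → ℝ) : Prop :=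
  Measurable ((sphere (0 : EuclideanSpace ℝ (Fin n)) 1).domRestrict a) ∧
    ∀ θ ∈ sphere (0 : EuclideanSpace ℝ (Fin n)) 1, lam ≤ a θ ∧ a θ ≤ Lam

/-- The integrand `y ↦ ((u(x+y) + u(x-y))/2 - u(x)) a(y/|y|) / |y|^{n+2s}`. -/
noncomputable def stableIntegrand {n : ℕ} (s : ℝ) (a u : EuclideanSpace ℝ (Fin n) → ℝ)
    (x y : EuclideanSpace ℝ (Fin n)) : ℝ :=
  ((u (x + y) + u (x - y)) / 2 - u x) * (a (‖y‖⁻¹ • y) / ‖y‖ ^ ((n : ℝ) + 2 * s))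

/-- The operator `Lu(x) = ∫ ((u(x+y) + u(x-y))/2 - u(x)) a(y/|y|) / |y|^{n+2s} dy`. -/
noncomputable def stableOperator {n : ℕ} (s : ℝ) (a u : EuclideanSpace ℝ (Fin n) → ℝ)
    (x : EuclideanSpace ℝ (Fin n)) : ℝ :=
  ∫ y, stableIntegrand s a u x y

/-! Fix `x ∈ Ω` and freeze the first-order Taylor polynomial `ℓ(y) = d(x) + ∇d(x)·y`. Every stable
operator annihilates `ℓ₊ ^ s` at the origin: in polar coordinates the integral splits into rays, on
each of which it is the one-dimensional identity `integral_Ioi_halfLineDiff_mul`, whatever the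
density `a` does (`integral_halfLineDiff_mul_stableKernel`). Hence `L(d^s)(x)` only sees the
remainder `d(x+y)^s - ℓ₊(y)^s`, and it suffices to bound that remainder in `L¹` with weight
`|y|^(-n-2s)`, uniformly in `x`.

For small `y`, `d(x+y)` differs from `ℓ₊(y)` by `O(|y|^(1+α))`, also across the boundary
(`IsDistanceFunction.exists_hasTaylorBound`), so the remainder is at most a multiple of `|y|^(1+α)
|ℓ(y)|^(s-1)`. The singularity of `ℓ` on a hyperplane is integrable: over a ball of radius `R` the
factor `|ℓ|^(s-1)` has mass `O(R^(n+s-1))`. Summing over dyadic annuli, the weight `|y|^(1+α-n-2s)`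
is admissible exactly because `s < α`. For large `y` the remainder grows at most like `|y|^s`, which
the kernel absorbs.

Uniformity in `x` comes from a dichotomy: near the boundary the gradient has norm at least one,
which gives the slab estimate with a fixed constant; elsewhere `d(x)` is bounded below and `ℓ` stays
away from zero on a fixed small ball. -/

/-! ### The one-dimensional identity for half-line powers. -/

/-- The symmetric second difference at `0` of `t ↦ (1 + t)₊ ^ s`. -/
noncomputable def halfLineDiff (s t : ℝ) : ℝ :=
  (max (1 + t) 0 ^ s + max (1 - t) 0 ^ s) / 2 - 1

lemma halfLineDiff_neg (s t : ℝ) : halfLineDiff s (-t) = halfLineDiff s t := by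
  simp only [halfLineDiff, sub_neg_eq_add, ← sub_eq_add_neg]
  ring

lemma continuous_halfLineDiff {s : ℝ} (hs : 0 ≤ s) : Continuous (halfLineDiff s) := by
  unfold halfLineDiff
  have h1 : Continuous fun t : ℝ => max (1 + t) 0 ^ s :=
    (by fun_prop : Continuous fun t : ℝ => max (1 + t) 0).rpow_const fun _ => Or.inr hs
  have h2 : Continuous fun t : ℝ => max (1 - t) 0 ^ s :=
    (by fun_prop : Continuous fun t : ℝ => max (1 - t) 0).rpow_const fun _ => Or.inr hs
  fun_prop

/-- Growth bound for the positive-part power. -/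
lemma max_rpow_le {s : ℝ} (hs : s ∈ Ioo (0 : ℝ) 1) {r t : ℝ} (ht : t ≤ 1 + r) (hr : 0 ≤ r) :
    max t 0 ^ s ≤ 1 + r := by
  calc max t 0 ^ s ≤ (1 + r) ^ s :=
        Real.rpow_le_rpow (le_max_right _ _) (max_le ht (by linarith)) hs.1.le
    _ ≤ (1 + r) ^ (1 : ℝ) := Real.rpow_le_rpow_of_exponent_le (by linarith) hs.2.le
    _ = 1 + r := Real.rpow_one _

/-- For `|t| ≤ 1`, Bernoulli's inequality makes the difference nonpositive, and the
arithmetic-geometric mean inequality with `((1+t)(1-t))^s ≥ 1 - t²` bounds it below. For `|t| ≥ 1`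
linear growth suffices. -/
lemma abs_halfLineDiff_le_sq {s : ℝ} (hs : s ∈ Ioo (0 : ℝ) 1) (t : ℝ) :
    |halfLineDiff s t| ≤ t ^ 2 * 3 := by
  wlog ht : 0 ≤ t generalizing t
  · have := this (-t) (by linarith)
    rwa [halfLineDiff_neg, neg_sq] at this
  rcases le_total t 1 with h1 | h1
  · unfold halfLineDiff
    rw [max_eq_left (by linarith : (0 : ℝ) ≤ 1 + t), max_eq_left (by linarith : (0 : ℝ) ≤ 1 - t)]
    have ha := rpow_one_add_le_one_add_mul_self (s := t) (by linarith) hs.1.le hs.2.le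
    have hb := rpow_one_add_le_one_add_mul_self (s := -t) (by linarith) hs.1.le hs.2.le
    rw [← sub_eq_add_neg] at hb
    have hc : 1 - t ^ 2 ≤ (1 + t) ^ s * (1 - t) ^ s := by
      rw [← Real.mul_rpow (by linarith) (by linarith)]
      have h0 : (0 : ℝ) ≤ 1 - t ^ 2 := by nlinarith
      calc 1 - t ^ 2 = (1 - t ^ 2) ^ (1 : ℝ) := (Real.rpow_one _).symm
        _ ≤ (1 - t ^ 2) ^ s := by
            rcases h0.eq_or_lt with h | h
            · rw [← h, Real.zero_rpow hs.1.ne', Real.zero_rpow one_ne_zero]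
            · exact Real.rpow_le_rpow_of_exponent_ge h (by nlinarith) hs.2.le
        _ = ((1 + t) * (1 - t)) ^ s := by congr 1; ring
    have hA : 0 ≤ (1 + t) ^ s := Real.rpow_nonneg (by linarith) _
    have hB : 0 ≤ (1 - t) ^ s := Real.rpow_nonneg (by linarith) _
    rw [abs_le]
    constructor
    · nlinarith [sq_nonneg ((1 + t) ^ s - (1 - t) ^ s), sq_nonneg (1 - t ^ 2)]
    · nlinarith
  · unfold halfLineDiff
    have ha := max_rpow_le hs (r := t) (t := 1 + t) le_rfl ht
    have hb := max_rpow_le hs (r := t) (t := 1 - t) (by linarith) ht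
    have hA : 0 ≤ max (1 + t) 0 ^ s := Real.rpow_nonneg (le_max_right _ _) _
    have hB : 0 ≤ max (1 - t) 0 ^ s := Real.rpow_nonneg (le_max_right _ _) _
    rw [abs_le]
    constructor <;> nlinarith

lemma abs_halfLineDiff_le_rpow {s : ℝ} (hs : s ∈ Ioo (0 : ℝ) 1) (t : ℝ) :
    |halfLineDiff s t| ≤ (1 + |t|) ^ s := by
  have hA : 0 ≤ max (1 + t) 0 ^ s := Real.rpow_nonneg (le_max_right _ _) _
  have hB : 0 ≤ max (1 - t) 0 ^ s := Real.rpow_nonneg (le_max_right _ _) _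
  have h1 : max (1 + t) 0 ^ s ≤ (1 + |t|) ^ s :=
    Real.rpow_le_rpow (le_max_right _ _)
      (max_le (by linarith [le_abs_self t]) (by positivity)) hs.1.le
  have h2 : max (1 - t) 0 ^ s ≤ (1 + |t|) ^ s :=
    Real.rpow_le_rpow (le_max_right _ _)
      (max_le (by linarith [neg_abs_le t]) (by positivity)) hs.1.le
  have h3 : (1 : ℝ) ≤ (1 + |t|) ^ s :=
    Real.one_le_rpow (by linarith [abs_nonneg t]) hs.1.le
  unfold halfLineDiff
  rw [abs_le]
  constructor <;> linarith

/-- The integrand is `O(t^(1-2s))` at zero and `O(t^(-1-s))` at infinity. -/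
lemma integrableOn_halfLineDiff {s : ℝ} (hs : s ∈ Ioo (0 : ℝ) 1) :
    IntegrableOn (fun t => halfLineDiff s t * t ^ (-(1 + 2 * s))) (Ioi 0) := by
  have hm : ∀ S : Set ℝ, AEStronglyMeasurable
      (fun t => halfLineDiff s t * t ^ (-(1 + 2 * s))) (volume.restrict S) := fun S =>
    ((continuous_halfLineDiff hs.1.le).measurable.mul
      (measurable_id.pow_const _)).aestronglyMeasurable
  rw [← Ioc_union_Ioi_eq_Ioi (zero_le_one' ℝ)]
  refine IntegrableOn.union ?_ ?_
  · have h : IntegrableOn (fun t : ℝ => 3 * t ^ (1 - 2 * s)) (Ioc 0 1) :=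
      ((intervalIntegrable_iff_integrableOn_Ioc_of_le zero_le_one).1
        (intervalIntegral.intervalIntegrable_rpow' (by linarith [hs.2]))).const_mul 3
    refine Integrable.mono' h (hm _) ((ae_restrict_mem measurableSet_Ioc).mono fun t ht => ?_)
    rw [norm_mul, Real.norm_eq_abs, Real.norm_eq_abs, abs_of_nonneg (Real.rpow_nonneg ht.1.le _)]
    calc |halfLineDiff s t| * t ^ (-(1 + 2 * s)) ≤ t ^ 2 * 3 * t ^ (-(1 + 2 * s)) :=
          mul_le_mul_of_nonneg_right (abs_halfLineDiff_le_sq hs t) (Real.rpow_nonneg ht.1.le _)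
      _ = 3 * t ^ (1 - 2 * s) := by
          rw [← Real.rpow_natCast t 2, mul_right_comm, ← Real.rpow_add ht.1, mul_comm]
          congr 2; push_cast; ring
  · have h : IntegrableOn (fun t : ℝ => 2 ^ s * t ^ (-(1 + s))) (Ioi 1) :=
      (integrableOn_Ioi_rpow_of_lt (by linarith [hs.1]) zero_lt_one).const_mul _
    refine Integrable.mono' h (hm _) ((ae_restrict_mem measurableSet_Ioi).mono fun t ht => ?_)
    have ht0 : (0 : ℝ) < t := zero_lt_one.trans ht
    rw [norm_mul, Real.norm_eq_abs, Real.norm_eq_abs, abs_of_nonneg (Real.rpow_nonneg ht0.le _)]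
    calc |halfLineDiff s t| * t ^ (-(1 + 2 * s)) ≤ (2 * t) ^ s * t ^ (-(1 + 2 * s)) := by
          refine mul_le_mul_of_nonneg_right ((abs_halfLineDiff_le_rpow hs t).trans ?_)
            (Real.rpow_nonneg ht0.le _)
          refine Real.rpow_le_rpow (by positivity) ?_ hs.1.le
          rw [abs_of_pos ht0]; linarith [mem_Ioi.1 ht]
      _ = 2 ^ s * t ^ (-(1 + s)) := by
          rw [Real.mul_rpow zero_le_two ht0.le, mul_assoc, ← Real.rpow_add ht0]
          congr 2; ring

lemma intervalIntegrable_one_sub_rpow_mul {p q a b : ℝ} (hp : -1 < p) (ha : 0 < a) (hab : a ≤ b) :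
    IntervalIntegrable (fun w : ℝ => (1 - w) ^ p * w ^ q) volume a b := by
  have h : IntervalIntegrable (fun w : ℝ => (1 - w) ^ p) volume a b := by
    simpa using (intervalIntegral.intervalIntegrable_rpow' hp
      (a := 1 - a) (b := 1 - b)).comp_sub_left 1
  refine h.mul_continuousOn fun w hw => ?_
  rw [uIcc_of_le hab] at hw
  exact (Real.continuousAt_rpow_const w q (Or.inl (ha.trans_le hw.1).ne')).continuousWithinAt

/-- Neither incomplete Beta integral is elementary, but the sum of the integrands is the derivative
of `-(1-w)^s w^(-2s) / s`. -/
lemma integral_one_sub_rpow_mul_add {s : ℝ} (hs : s ∈ Ioo (0 : ℝ) 1) {a : ℝ} (ha : 0 < a)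
    (ha1 : a < 1) :
    (∫ w in a..1, (1 - w) ^ (s - 1) * w ^ (-(1 + 2 * s))) +
      ∫ w in a..1, (1 - w) ^ s * w ^ (-(1 + 2 * s)) = (1 - a) ^ s * a ^ (-(2 * s)) / s := by
  have hs0 : s ≠ 0 := hs.1.ne'
  have i1 := intervalIntegrable_one_sub_rpow_mul (p := s - 1) (q := -(1 + 2 * s))
    (by linarith [hs.1]) ha ha1.le
  have i2 := intervalIntegrable_one_sub_rpow_mul (p := s) (q := -(1 + 2 * s))
    (by linarith [hs.1]) ha ha1.le
  rw [← intervalIntegral.integral_add i1 i2,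
    intervalIntegral.integral_eq_sub_of_hasDerivAt_of_le (a := a) (b := 1)
      (f := fun w => -((1 - w) ^ s * w ^ (-(2 * s)) / s)) ha1.le ?_ ?_ (i1.add i2)]
  · simp [Real.zero_rpow hs0]
  · intro w hw
    have hw0 : w ≠ 0 := (ha.trans_le hw.1).ne'
    refine ContinuousAt.continuousWithinAt ?_
    have c1 : ContinuousAt (fun w : ℝ => (1 - w) ^ s) w :=
      (by fun_prop : ContinuousAt (fun w : ℝ => 1 - w) w).rpow_const (Or.inr hs.1.le)
    have c2 := Real.continuousAt_rpow_const w (-(2 * s)) (Or.inl hw0)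
    exact ((c1.mul c2).div_const s).neg
  · intro w hw
    have hw0 : 0 < w := ha.trans hw.1
    have hw1 : 0 < 1 - w := by linarith [hw.2]
    have d1 : HasDerivAt (fun w : ℝ => (1 - w) ^ s) (-1 * s * (1 - w) ^ (s - 1)) w :=
      ((hasDerivAt_id w).const_sub 1).rpow_const (Or.inl hw1.ne')
    have d2 := Real.hasDerivAt_rpow_const (x := w) (p := -(2 * s)) (Or.inl hw0.ne')
    refine ((d1.mul d2).div_const s).neg.congr_deriv ?_
    have e1 : (1 - w) ^ s = (1 - w) ^ (s - 1) * (1 - w) := by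
      rw [Real.rpow_sub_one hw1.ne']; field_simp
    have e2 : w ^ (-(2 * s)) = w ^ (-(1 + 2 * s)) * w := by
      rw [← Real.rpow_add_one hw0.ne']; congr 1; ring
    have e3 : -(2 * s) - 1 = -(1 + 2 * s) := by ring
    rw [e3, e1, e2]
    field_simp
    ring

/-- Substitute `t = w/(1-w)`, so that `1 + t = (1-w)⁻¹`. This brings the unbounded branch of the
second difference to the same Beta form as the bounded one. -/
lemma integral_Ioi_one_add_rpow_mul {s ε : ℝ} (hε : 0 < ε) :
    ∫ t in Ioi ε, (1 + t) ^ s * t ^ (-(1 + 2 * s)) =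
      ∫ w in (ε / (1 + ε))..1, (1 - w) ^ (s - 1) * w ^ (-(1 + 2 * s)) := by
  have hε' : 0 < ε / (1 + ε) := by positivity
  have hε1 : ε / (1 + ε) < 1 := by rw [div_lt_one (by positivity)]; linarith
  have himg : (fun w : ℝ => w / (1 - w)) '' Ioo (ε / (1 + ε)) 1 = Ioi ε := by
    ext t
    simp only [mem_image, mem_Ioo, mem_Ioi]
    constructor
    · rintro ⟨w, ⟨h1, h2⟩, rfl⟩
      rw [div_lt_iff₀ (by positivity)] at h1
      rw [lt_div_iff₀ (by linarith)]
      nlinarith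
    · intro ht
      have ht0 : 0 < t := hε.trans ht
      refine ⟨t / (1 + t), ⟨?_, ?_⟩, ?_⟩
      · rw [div_lt_div_iff₀ (by positivity) (by positivity)]; nlinarith
      · rw [div_lt_one (by positivity)]; linarith
      · field_simp; ring
  rw [intervalIntegral.integral_of_le hε1.le, integral_Ioc_eq_integral_Ioo, ← himg,
    integral_image_eq_integral_abs_deriv_smul (f' := fun w => ((1 - w) ^ 2)⁻¹) measurableSet_Ioo]
  · refine setIntegral_congr_fun measurableSet_Ioo fun w hw => ?_
    have hw0 : 0 < w := hε'.trans hw.1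
    have hw1 : 0 < 1 - w := by linarith [hw.2]
    have e0 : 1 + w / (1 - w) = (1 - w)⁻¹ := by field_simp; ring
    simp only [smul_eq_mul]
    rw [e0, abs_of_pos (by positivity), Real.div_rpow hw0.le hw1.le, Real.inv_rpow hw1.le,
      ← Real.rpow_natCast (1 - w) 2, ← Real.rpow_neg hw1.le, ← Real.rpow_neg hw1.le,
      div_eq_mul_inv, ← Real.rpow_neg hw1.le, mul_comm (w ^ _), ← mul_assoc, ← mul_assoc,
      ← Real.rpow_add hw1, ← Real.rpow_add hw1]
    congr 2
    push_cast; ring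
  · intro w hw
    have hw1 : 1 - w ≠ 0 := by linarith [hw.2]
    refine HasDerivAt.hasDerivWithinAt ?_
    refine ((hasDerivAt_id w).div ((hasDerivAt_id w).const_sub 1) hw1).congr_deriv ?_
    simp only [id]; field_simp; ring
  · intro w hw w' hw' h
    have h1 : 1 - w ≠ 0 := by linarith [hw.2]
    have h2 : 1 - w' ≠ 0 := by linarith [hw'.2]
    simp only at h
    rw [div_eq_div_iff h1 h2] at h
    linarith

lemma integrableOn_Ioi_one_add_rpow_mul {s : ℝ} (hs : s ∈ Ioo (0 : ℝ) 1) {ε : ℝ} (hε : 0 < ε) :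
    IntegrableOn (fun t : ℝ => (1 + t) ^ s * t ^ (-(1 + 2 * s))) (Ioi ε) := by
  have h : IntegrableOn (fun t : ℝ => ((1 + ε) / ε) ^ s * t ^ (-(1 + s))) (Ioi ε) :=
    (integrableOn_Ioi_rpow_of_lt (by linarith [hs.1]) hε).const_mul _
  refine Integrable.mono' h (by fun_prop) ((ae_restrict_mem measurableSet_Ioi).mono fun t ht => ?_)
  have ht0 : 0 < t := hε.trans ht
  rw [Real.norm_eq_abs, abs_of_nonneg (by positivity)]
  have e : t ^ (-(1 + s)) = t ^ s * t ^ (-(1 + 2 * s)) := by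
    rw [← Real.rpow_add ht0]; congr 1; ring
  rw [e, ← mul_assoc, ← Real.mul_rpow (by positivity) ht0.le]
  refine mul_le_mul_of_nonneg_right (Real.rpow_le_rpow (by positivity) ?_ hs.1.le) (by positivity)
  rw [div_mul_eq_mul_div, le_div_iff₀ hε]
  nlinarith [mem_Ioi.1 ht]

/-- Truncation leaves one Beta integral from `ε/(1+ε)` and the other from `ε`. Adding
`integral_one_sub_rpow_mul_add` at both lower limits evaluates everything, up to an integral over
the short gap between the limits. The boundary terms recombine into `halfLineDiff s ε`. -/
lemma four_mul_integral_Ioi_halfLineDiff {s : ℝ} (hs : s ∈ Ioo (0 : ℝ) 1) {ε : ℝ} (hε : 0 < ε)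
    (hε1 : ε < 1) :
    4 * ∫ t in Ioi ε, halfLineDiff s t * t ^ (-(1 + 2 * s)) =
      2 / s * (halfLineDiff s ε * ε ^ (-(2 * s))) +
        ∫ w in (ε / (1 + ε))..ε, (1 - w) ^ (s - 1) * w ^ (-(2 * s)) := by
  have hs0 : s ≠ 0 := hs.1.ne'
  set ε' := ε / (1 + ε) with hε'def
  have hε' : 0 < ε' := by positivity
  have hε'ε : ε' ≤ ε := div_le_self hε.le (by linarith)
  have iP := integrableOn_Ioi_one_add_rpow_mul hs hε
  have iR : IntegrableOn (fun t : ℝ => t ^ (-(1 + 2 * s))) (Ioi ε) :=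
    integrableOn_Ioi_rpow_of_lt (by linarith [hs.1]) hε
  have iQ : IntegrableOn (fun t : ℝ => max (1 - t) 0 ^ s * t ^ (-(1 + 2 * s))) (Ioi ε) := by
    refine Integrable.mono iP (by fun_prop)
      ((ae_restrict_mem measurableSet_Ioi).mono fun t ht => ?_)
    have ht0 : 0 < t := hε.trans ht
    have h0 : 0 ≤ max (1 - t) 0 := le_max_right _ _
    rw [Real.norm_of_nonneg (by positivity), Real.norm_of_nonneg (by positivity)]
    exact mul_le_mul_of_nonneg_right (Real.rpow_le_rpow h0
      (max_le (by linarith) (by linarith)) hs.1.le) (by positivity)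
  have eQ : ∫ t in Ioi ε, max (1 - t) 0 ^ s * t ^ (-(1 + 2 * s)) =
      ∫ w in ε..1, (1 - w) ^ s * w ^ (-(1 + 2 * s)) := by
    rw [intervalIntegral.integral_of_le hε1.le,
      setIntegral_eq_of_subset_of_forall_sdiff_eq_zero measurableSet_Ioi
        (Ioc_subset_Ioi_self : Ioc ε 1 ⊆ Ioi ε)]
    · refine setIntegral_congr_fun measurableSet_Ioc fun t ht => ?_
      simp only [max_eq_left (sub_nonneg.2 ht.2)]
    · intro t ht
      have : 1 < t := by
        by_contra h
        exact ht.2 ⟨ht.1, not_lt.1 h⟩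
      rw [max_eq_right (by linarith), Real.zero_rpow hs0, zero_mul]
  have e1 : 2 * ∫ t in Ioi ε, halfLineDiff s t * t ^ (-(1 + 2 * s)) =
      (∫ w in ε'..1, (1 - w) ^ (s - 1) * w ^ (-(1 + 2 * s))) +
      (∫ w in ε..1, (1 - w) ^ s * w ^ (-(1 + 2 * s))) - ε ^ (-(2 * s)) / s := by
    have hR : ∫ t in Ioi ε, t ^ (-(1 + 2 * s)) = ε ^ (-(2 * s)) / (2 * s) := by
      rw [integral_Ioi_rpow_of_lt (by linarith [hs.1]) hε,
        show -(1 + 2 * s) + 1 = -(2 * s) by ring]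
      rw [neg_div_neg_eq]
    rw [← eQ, ← integral_Ioi_one_add_rpow_mul hε, ← integral_const_mul, ← integral_add iP iQ]
    have : ε ^ (-(2 * s)) / s = ∫ t in Ioi ε, 2 * t ^ (-(1 + 2 * s)) := by
      rw [integral_const_mul, hR]; field_simp
    have hsub := integral_sub (iP.add iQ) (iR.const_mul 2)
    simp only [Pi.add_apply] at hsub
    rw [this, ← hsub]
    refine setIntegral_congr_fun measurableSet_Ioi fun t ht => ?_
    have ht0 : 0 < t := hε.trans ht
    simp only [halfLineDiff, max_eq_left (by linarith : (0 : ℝ) ≤ 1 + t)]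
    ring
  have T1 := integral_one_sub_rpow_mul_add hs hε hε1
  have T2 := integral_one_sub_rpow_mul_add hs hε' (hε'ε.trans_lt hε1)
  have j1 : ∀ {a b : ℝ}, 0 < a → a ≤ b → IntervalIntegrable
      (fun w : ℝ => (1 - w) ^ (s - 1) * w ^ (-(1 + 2 * s))) volume a b := fun ha hab =>
    intervalIntegrable_one_sub_rpow_mul (by linarith [hs.1]) ha hab
  have j2 : ∀ {a b : ℝ}, 0 < a → a ≤ b → IntervalIntegrable
      (fun w : ℝ => (1 - w) ^ s * w ^ (-(1 + 2 * s))) volume a b := fun ha hab =>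
    intervalIntegrable_one_sub_rpow_mul (by linarith [hs.1]) ha hab
  have A1 := intervalIntegral.integral_add_adjacent_intervals (j1 hε' hε'ε) (j1 hε hε1.le)
  have A2 := intervalIntegral.integral_add_adjacent_intervals (j2 hε' hε'ε) (j2 hε hε1.le)
  have D : ∫ w in ε'..ε, (1 - w) ^ (s - 1) * w ^ (-(2 * s)) =
      (∫ w in ε'..ε, (1 - w) ^ (s - 1) * w ^ (-(1 + 2 * s))) -
        ∫ w in ε'..ε, (1 - w) ^ s * w ^ (-(1 + 2 * s)) := by
    rw [← intervalIntegral.integral_sub (j1 hε' hε'ε) (j2 hε' hε'ε)]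
    refine intervalIntegral.integral_congr fun w hw => ?_
    rw [uIcc_of_le hε'ε] at hw
    have hw0 : 0 < w := hε'.trans_le hw.1
    have hw1 : 0 < 1 - w := by linarith [hw.2]
    have f1 : (1 - w) ^ s = (1 - w) ^ (s - 1) * (1 - w) := by
      rw [← Real.rpow_add_one hw1.ne']; congr 1; ring
    have f2 : w ^ (-(2 * s)) = w ^ (-(1 + 2 * s)) * w := by
      rw [← Real.rpow_add_one hw0.ne']; congr 1; ring
    simp only [f1, f2]
    ring
  have hT : (1 - ε') ^ s * ε' ^ (-(2 * s)) = (1 + ε) ^ s * ε ^ (-(2 * s)) := by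
    have h1 : 1 - ε' = (1 + ε)⁻¹ := by rw [hε'def]; field_simp; ring
    rw [h1, hε'def, Real.div_rpow hε.le (by positivity), Real.inv_rpow (by positivity),
      ← Real.rpow_neg (by positivity), div_eq_mul_inv, ← Real.rpow_neg (by positivity),
      mul_comm (ε ^ _), ← mul_assoc, ← Real.rpow_add (by positivity)]
    congr 2; ring
  rw [hT] at T2
  have hψ : 2 / s * (halfLineDiff s ε * ε ^ (-(2 * s))) =
      (1 + ε) ^ s * ε ^ (-(2 * s)) / s + (1 - ε) ^ s * ε ^ (-(2 * s)) / s
        - 2 * (ε ^ (-(2 * s)) / s) := by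
    simp only [halfLineDiff, max_eq_left (by linarith : (0 : ℝ) ≤ 1 + ε),
      max_eq_left (by linarith : (0 : ℝ) ≤ 1 - ε)]
    field_simp
  rw [hψ, D]
  linarith

/-- Both terms of the truncated formula are `O(ε^(2-2s))`: the second difference is `O(ε²)`, and the
gap has length at most `ε²` with integrand `O(ε^(-2s))`. Since `s < 1`, the limit is zero. -/
lemma integral_Ioi_halfLineDiff {s : ℝ} (hs : s ∈ Ioo (0 : ℝ) 1) :
    ∫ t in Ioi 0, halfLineDiff s t * t ^ (-(1 + 2 * s)) = 0 := by
  have lim : Filter.Tendsto (fun ε : ℝ => ∫ t in Ioi ε, halfLineDiff s t * t ^ (-(1 + 2 * s)))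
      (𝓝[>] 0) (𝓝 (∫ t in Ioi 0, halfLineDiff s t * t ^ (-(1 + 2 * s)))) := by
    have hc : AECover (volume.restrict (Ioi (0 : ℝ))) (𝓝[>] (0 : ℝ)) fun ε => Ioi ε :=
      aecover_Ioi_of_Ioi (Filter.tendsto_id.mono_left nhdsWithin_le_nhds)
    refine (hc.integral_tendsto_of_countably_generated
      (integrableOn_halfLineDiff hs)).congr' ?_
    filter_upwards [self_mem_nhdsWithin] with ε hε
    rw [Measure.restrict_restrict measurableSet_Ioi,
      inter_eq_left.2 (Ioi_subset_Ioi (le_of_lt hε))]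
  refine tendsto_nhds_unique lim (squeeze_zero_norm' (a := fun ε : ℝ =>
    (6 / s + 8) / 4 * ε ^ (2 - 2 * s)) ?_ ?_)
  · have h12 : Ioo (0 : ℝ) (1 / 2) ∈ 𝓝[>] (0 : ℝ) := Ioo_mem_nhdsGT (by norm_num)
    filter_upwards [h12] with ε hε
    have hε0 := hε.1
    have hεh := hε.2
    have hs1 := hs.1
    have hs2 := hs.2
    have key := four_mul_integral_Ioi_halfLineDiff hs hε.1 (by linarith)
    have hε' : 0 < ε / (1 + ε) := by positivity
    have hε'ε : ε / (1 + ε) ≤ ε := div_le_self hε0.le (by linarith)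
    have hsplit : ε ^ (2 - 2 * s) = ε ^ 2 * ε ^ (-(2 * s)) := by
      rw [← Real.rpow_natCast ε 2, ← Real.rpow_add hε0]; congr 1
    have b1 : |2 / s * (halfLineDiff s ε * ε ^ (-(2 * s)))| ≤ 6 / s * ε ^ (2 - 2 * s) := by
      rw [abs_mul, abs_mul, abs_of_pos (by positivity : 0 < 2 / s),
        abs_of_pos (by positivity : 0 < ε ^ (-(2 * s))), hsplit]
      calc 2 / s * (|halfLineDiff s ε| * ε ^ (-(2 * s)))
          ≤ 2 / s * (ε ^ 2 * 3 * ε ^ (-(2 * s))) := by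
            gcongr; exact abs_halfLineDiff_le_sq hs ε
        _ = 6 / s * (ε ^ 2 * ε ^ (-(2 * s))) := by ring
    have b2 : |∫ w in (ε / (1 + ε))..ε, (1 - w) ^ (s - 1) * w ^ (-(2 * s))|
        ≤ 8 * ε ^ (2 - 2 * s) := by
      rw [← Real.norm_eq_abs]
      refine (intervalIntegral.norm_integral_le_of_norm_le_const
        (C := 2 * (4 * ε ^ (-(2 * s)))) fun w hw => ?_).trans ?_
      · rw [uIoc_of_le hε'ε] at hw
        have hw0 : 0 < w := hε'.trans hw.1
        have hw1 : 1 / 2 ≤ 1 - w := by linarith [hw.2]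
        rw [Real.norm_of_nonneg (mul_nonneg (Real.rpow_nonneg (by linarith) _)
          (Real.rpow_nonneg hw0.le _))]
        refine mul_le_mul ?_ ?_ (Real.rpow_nonneg hw0.le _) zero_le_two
        · calc (1 - w) ^ (s - 1) ≤ (1 / 2 : ℝ) ^ (s - 1) :=
                Real.rpow_le_rpow_of_nonpos (by norm_num) hw1 (by linarith)
            _ ≤ (1 / 2 : ℝ) ^ (-1 : ℝ) :=
                Real.rpow_le_rpow_of_exponent_ge (by norm_num) (by norm_num) (by linarith)
            _ = 2 := by rw [Real.rpow_neg_one]; norm_num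
        · have hle : 1 / 2 * ε ≤ w := by
            refine le_trans ?_ hw.1.le
            rw [le_div_iff₀ (by positivity)]; nlinarith
          calc w ^ (-(2 * s)) ≤ (1 / 2 * ε) ^ (-(2 * s)) :=
                Real.rpow_le_rpow_of_nonpos (by positivity) hle (by linarith)
            _ = (1 / 2) ^ (-(2 * s)) * ε ^ (-(2 * s)) :=
                Real.mul_rpow (by norm_num) hε0.le
            _ ≤ 4 * ε ^ (-(2 * s)) := by
                gcongr
                calc (1 / 2 : ℝ) ^ (-(2 * s)) ≤ (1 / 2 : ℝ) ^ (-2 : ℝ) :=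
                      Real.rpow_le_rpow_of_exponent_ge (by norm_num) (by norm_num) (by linarith)
                  _ = 4 := by
                      rw [Real.rpow_neg (by norm_num)]; norm_num
      · rw [abs_of_nonneg (by linarith), hsplit]
        have hd : ε - ε / (1 + ε) ≤ ε ^ 2 := by
          rw [sub_le_iff_le_add, ← sub_le_iff_le_add', le_div_iff₀ (by positivity)]
          nlinarith [pow_pos hε0 3]
        calc 2 * (4 * ε ^ (-(2 * s))) * (ε - ε / (1 + ε))
            ≤ 2 * (4 * ε ^ (-(2 * s))) * ε ^ 2 := by gcongr
          _ = 8 * (ε ^ 2 * ε ^ (-(2 * s))) := by ring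
    rw [Real.norm_eq_abs]
    have h4 : |4 * ∫ t in Ioi ε, halfLineDiff s t * t ^ (-(1 + 2 * s))| ≤
        6 / s * ε ^ (2 - 2 * s) + 8 * ε ^ (2 - 2 * s) := by
      rw [key]; exact (abs_add_le _ _).trans (add_le_add b1 b2)
    rw [abs_mul, abs_of_pos (by norm_num : (0 : ℝ) < 4)] at h4
    linarith
  · have h : Filter.Tendsto (fun ε : ℝ => (6 / s + 8) / 4 * ε ^ (2 - 2 * s)) (𝓝 0)
        (𝓝 ((6 / s + 8) / 4 * 0 ^ (2 - 2 * s))) :=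
      ((Real.continuousAt_rpow_const 0 _ (Or.inr (by linarith [hs.2]))).tendsto).const_mul _
    rw [Real.zero_rpow (by linarith [hs.2]), mul_zero] at h
    exact h.mono_left nhdsWithin_le_nhds

/-- Evenness reduces to `b ≥ 0`, and scaling to `b = 1`. -/
lemma integral_Ioi_halfLineDiff_mul {s : ℝ} (hs : s ∈ Ioo (0 : ℝ) 1) (b : ℝ) :
    ∫ t in Ioi 0, halfLineDiff s (b * t) * t ^ (-(1 + 2 * s)) = 0 := by
  wlog hb : 0 ≤ b generalizing b
  · simpa only [neg_mul, halfLineDiff_neg] using this (-b) (by linarith)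
  rcases hb.eq_or_lt with rfl | hb
  · simp [halfLineDiff]
  have h := integral_comp_mul_left_Ioi (fun t => halfLineDiff s t * t ^ (-(1 + 2 * s))) 0 hb
  rw [mul_zero, integral_Ioi_halfLineDiff hs, smul_zero] at h
  have h2 : ∫ t in Ioi 0, b ^ (-(1 + 2 * s)) * (halfLineDiff s (b * t) * t ^ (-(1 + 2 * s))) =
      0 := by
    refine Eq.trans ?_ h
    refine setIntegral_congr_fun measurableSet_Ioi fun t ht => ?_
    simp only [Real.mul_rpow hb.le (le_of_lt ht)]
    ring
  rw [integral_const_mul] at h2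
  exact (mul_eq_zero.1 h2).resolve_left (Real.rpow_pos_of_pos hb _).ne'

/-! ### Polar coordinates and annihilation of powers of affine functions. -/

section Polar

variable {E : Type*} [NormedAddCommGroup E] [NormedSpace ℝ E] [MeasurableSpace E] [BorelSpace E]
  [FiniteDimensional ℝ E] [Nontrivial E]

lemma integral_polar (μ : Measure E) [μ.IsAddHaarMeasure] {F : E → ℝ} (hF : Integrable F μ) :
    ∫ y, F y ∂μ = ∫ θ : sphere (0 : E) 1,
      (∫ r in Ioi (0 : ℝ), r ^ (Module.finrank ℝ E - 1) * F (r • (θ : E))) ∂μ.toSphere := by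
  have hmp := μ.measurePreserving_homeomorphUnitSphereProd
  have hemb := (homeomorphUnitSphereProd E).measurableEmbedding
  set G : sphere (0 : E) 1 × Ioi (0 : ℝ) → ℝ := fun p => F ((p.2 : ℝ) • (p.1 : E)) with hG
  have hcomp : ∀ x : ({0}ᶜ : Set E), G (homeomorphUnitSphereProd E x) = F x := by
    intro x
    have hx : ‖(x : E)‖ ≠ 0 := norm_ne_zero_iff.2 x.2
    simp [hG, smul_smul, mul_inv_cancel₀ hx]
  have hGint : Integrable G (μ.toSphere.prod (.volumeIoiPow (Module.finrank ℝ E - 1))) := by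
    rw [← hmp.integrable_comp_emb hemb]
    have : G ∘ homeomorphUnitSphereProd E = F ∘ ((↑) : ({0}ᶜ : Set E) → E) := by
      ext x; exact hcomp x
    rw [this, ← integrableOn_iff_comap_subtypeVal (measurableSet_singleton _).compl]
    exact hF.integrableOn
  calc ∫ y, F y ∂μ = ∫ x : ({0}ᶜ : Set E), F x ∂(μ.comap (↑)) := by
        rw [integral_subtype_comap (measurableSet_singleton _).compl F, restrict_compl_singleton]
    _ = ∫ p, G p ∂μ.toSphere.prod (.volumeIoiPow (Module.finrank ℝ E - 1)) := by
        rw [← hmp.integral_comp hemb G]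
        simp only [hcomp]
    _ = ∫ θ, (∫ r, G (θ, r) ∂.volumeIoiPow (Module.finrank ℝ E - 1)) ∂μ.toSphere :=
        integral_prod _ hGint
    _ = _ := by
        congr 1
        ext θ
        simp only [Measure.volumeIoiPow, ENNReal.ofReal]
        rw [integral_withDensity_eq_integral_smul
            ((measurable_subtype_coe.pow_const _).real_toNNReal),
          integral_subtype_comap measurableSet_Ioi
            fun r ↦ Real.toNNReal (r ^ (Module.finrank ℝ E - 1)) • F (r • (θ : E))]
        refine setIntegral_congr_fun measurableSet_Ioi fun r hr ↦ ?_
        simp only [NNReal.smul_def, Real.coe_toNNReal _ (pow_nonneg (le_of_lt hr) _), smul_eq_mul]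

/-- The polar Jacobian cancels the dimension in the kernel. Nontriviality keeps the natural
subtraction from truncating. -/
lemma pow_finrank_mul_rpow {E : Type*} [NormedAddCommGroup E] [NormedSpace ℝ E]
    [FiniteDimensional ℝ E] [Nontrivial E] {r : ℝ} (hr : 0 < r) (q : ℝ) :
    r ^ (Module.finrank ℝ E - 1) * r ^ (-((Module.finrank ℝ E : ℝ) + q)) = r ^ (-(1 + q)) := by
  have hd : 0 < Module.finrank ℝ E := Module.finrank_pos
  rw [← Real.rpow_natCast, ← Real.rpow_add hr]
  congr 1
  rw [Nat.cast_sub (by omega)]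
  push_cast; ring

/-- The kernel of a stable operator. -/
noncomputable def stableKernel {E : Type*} [NormedAddCommGroup E] [NormedSpace ℝ E]
    (s : ℝ) (a : E → ℝ) (y : E) : ℝ :=
  a (‖y‖⁻¹ • y) / ‖y‖ ^ ((Module.finrank ℝ E : ℝ) + 2 * s)

lemma measurable_stableKernel {E : Type*} [NormedAddCommGroup E] [NormedSpace ℝ E]
    [MeasurableSpace E] [BorelSpace E] [FiniteDimensional ℝ E] (s : ℝ) {a : E → ℝ}
    (ha : Measurable a) :
    Measurable (stableKernel s a) := by
  unfold stableKernel
  have h : Measurable fun y : E => ‖y‖⁻¹ • y := by fun_prop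
  have h2 : Measurable fun y : E => ‖y‖ ^ ((Module.finrank ℝ E : ℝ) + 2 * s) := by fun_prop
  exact (ha.comp h).div h2

lemma abs_stableKernel_le {E : Type*} [NormedAddCommGroup E] [NormedSpace ℝ E] (s : ℝ)
    {a : E → ℝ} {Lam : ℝ}
    (ha : ∀ θ ∈ sphere (0 : E) 1, |a θ| ≤ Lam) {y : E} (hy : y ≠ 0) :
    |stableKernel s a y| ≤ Lam * ‖y‖ ^ (-((Module.finrank ℝ E : ℝ) + 2 * s)) := by
  have h := ha (‖y‖⁻¹ • y) (by
    rw [mem_sphere_zero_iff_norm, norm_smul, norm_inv, norm_norm,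
      inv_mul_cancel₀ (norm_ne_zero_iff.2 hy)])
  have hp : 0 < ‖y‖ ^ ((Module.finrank ℝ E : ℝ) + 2 * s) :=
    Real.rpow_pos_of_pos (norm_pos_iff.2 hy) _
  rw [stableKernel, abs_div, abs_of_pos hp, Real.rpow_neg (norm_nonneg _), ← div_eq_mul_inv]
  gcongr

/-- A radial majorant, split at radius one, combines the quadratic bound near the origin with growth
of order `s` at infinity. -/
lemma integrable_halfLineDiff_mul_stableKernel (μ : Measure E) [μ.IsAddHaarMeasure] {s : ℝ}
    (hs : s ∈ Ioo (0 : ℝ) 1) {a : E → ℝ} (ham : Measurable a) {Lam : ℝ}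
    (ha : ∀ θ ∈ sphere (0 : E) 1, |a θ| ≤ Lam) (g : E →L[ℝ] ℝ) :
    Integrable (fun y => halfLineDiff s (g y) * stableKernel s a y) μ := by
  have hm : AEStronglyMeasurable (fun y => halfLineDiff s (g y) * stableKernel s a y) μ :=
    (((continuous_halfLineDiff hs.1.le).measurable.comp g.continuous.measurable).mul
      (measurable_stableKernel s ham)).aestronglyMeasurable
  have hL : 0 ≤ Lam := by
    obtain ⟨v, hv⟩ := exists_norm_eq E (zero_le_one' ℝ)
    exact (abs_nonneg _).trans (ha v (by simpa using hv))
  set M := ‖g‖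
  have hM : 0 ≤ M := norm_nonneg g
  set N := Module.finrank ℝ E with hN
  set φ : ℝ → ℝ := fun r => if r ≤ 1 then (M ^ 2 * 3 * Lam) * (r ^ 2 * r ^ (-((N : ℝ) + 2 * s)))
    else ((1 + M) ^ s * Lam) * (r ^ s * r ^ (-((N : ℝ) + 2 * s))) with hφ
  have hφi : Integrable (fun y : E => φ ‖y‖) μ := by
    rw [integrable_fun_norm_addHaar, ← Ioc_union_Ioi_eq_Ioi (zero_le_one' ℝ)]
    refine IntegrableOn.union ?_ ?_
    · have h : IntegrableOn (fun r : ℝ => (M ^ 2 * 3 * Lam) * r ^ (1 - 2 * s)) (Ioc 0 1) :=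
        ((intervalIntegrable_iff_integrableOn_Ioc_of_le zero_le_one).1
          (intervalIntegral.intervalIntegrable_rpow' (by linarith [hs.2]))).const_mul _
      refine h.congr_fun (fun r hr => ?_) measurableSet_Ioc
      simp only [hφ, if_pos hr.2, smul_eq_mul]
      have e := pow_finrank_mul_rpow (E := E) hr.1 (2 * s)
      have e2 : r ^ (1 - 2 * s) = r ^ 2 * r ^ (-(1 + 2 * s)) := by
        rw [← Real.rpow_natCast r 2, ← Real.rpow_add hr.1]; congr 1; push_cast; ring
      rw [e2, ← e]; ring
    · have h : IntegrableOn (fun r : ℝ => ((1 + M) ^ s * Lam) * r ^ (-(1 + s))) (Ioi 1) :=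
        (integrableOn_Ioi_rpow_of_lt (by linarith [hs.1]) zero_lt_one).const_mul _
      refine h.congr_fun (fun r hr => ?_) measurableSet_Ioi
      have hr0 : (0 : ℝ) < r := zero_lt_one.trans hr
      simp only [hφ, if_neg (not_le.2 (mem_Ioi.1 hr)), smul_eq_mul]
      have e := pow_finrank_mul_rpow (E := E) hr0 (2 * s)
      have e2 : r ^ (-(1 + s)) = r ^ s * r ^ (-(1 + 2 * s)) := by
        rw [← Real.rpow_add hr0]; congr 1; ring
      rw [e2, ← e]; ring
  refine hφi.mono' hm ?_
  filter_upwards [Measure.ae_ne μ (0 : E)] with y hy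
  have hy0 : 0 < ‖y‖ := norm_pos_iff.2 hy
  have hk := abs_stableKernel_le s ha hy
  have hg : |g y| ≤ M * ‖y‖ := g.le_opNorm y
  rw [norm_mul, Real.norm_eq_abs, Real.norm_eq_abs]
  simp only [hφ]
  split_ifs with h1
  · calc |halfLineDiff s (g y)| * |stableKernel s a y|
        ≤ ((M * ‖y‖) ^ 2 * 3) * (Lam * ‖y‖ ^ (-((N : ℝ) + 2 * s))) := by
          refine mul_le_mul ((abs_halfLineDiff_le_sq hs _).trans ?_) hk (abs_nonneg _)
            (by positivity)
          rw [← sq_abs (g y)]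
          gcongr
      _ = _ := by ring
  · rw [not_le] at h1
    calc |halfLineDiff s (g y)| * |stableKernel s a y|
        ≤ ((1 + M) * ‖y‖) ^ s * (Lam * ‖y‖ ^ (-((N : ℝ) + 2 * s))) := by
          refine mul_le_mul ((abs_halfLineDiff_le_rpow hs _).trans ?_) hk (abs_nonneg _)
            (by positivity)
          refine Real.rpow_le_rpow (by positivity) ?_ hs.1.le
          linarith
      _ = _ := by rw [Real.mul_rpow (by positivity) hy0.le]; ring

/-- Stable operators annihilate `(1 + g)₊ ^ s` at the origin, for every linear form `g`. -/
lemma integral_halfLineDiff_mul_stableKernel (μ : Measure E) [μ.IsAddHaarMeasure] {s : ℝ}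
    (hs : s ∈ Ioo (0 : ℝ) 1) {a : E → ℝ} (ham : Measurable a) {Lam : ℝ}
    (ha : ∀ θ ∈ sphere (0 : E) 1, |a θ| ≤ Lam) (g : E →L[ℝ] ℝ) :
    ∫ y, halfLineDiff s (g y) * stableKernel s a y ∂μ = 0 := by
  rw [integral_polar μ (integrable_halfLineDiff_mul_stableKernel μ hs ham ha g)]
  refine integral_eq_zero_of_ae (Filter.Eventually.of_forall fun θ => ?_)
  have hθ : ‖(θ : E)‖ = 1 := by simp
  -- On a ray the density is constant and `g` has slope `g θ`, so each ray contributes zero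
  -- separately.
  have h : ∫ r in Ioi (0 : ℝ), a θ * (halfLineDiff s (g θ * r) * r ^ (-(1 + 2 * s))) = 0 := by
    rw [integral_const_mul, integral_Ioi_halfLineDiff_mul hs, mul_zero]
  refine Eq.trans (setIntegral_congr_fun measurableSet_Ioi fun r hr => ?_) h
  have hr0 : 0 < r := hr
  have e := pow_finrank_mul_rpow (E := E) hr0 (2 * s)
  have hn : ‖r • (θ : E)‖ = r := by rw [norm_smul, hθ, mul_one, Real.norm_of_nonneg hr0.le]
  simp only [stableKernel, hn, smul_smul, inv_mul_cancel₀ hr0.ne', one_smul, map_smul, smul_eq_mul]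
  rw [← e, div_eq_mul_inv, ← Real.rpow_neg hr0.le, mul_comm r (g θ)]
  ring

end Polar

/-! ### Integrals of singular powers: lines, slabs, dyadic annuli and tails. -/

lemma measurable_ofReal_abs_rpow (p : ℝ) : Measurable fun t : ℝ => ENNReal.ofReal |t| ^ p := by
  fun_prop

lemma lintegral_Ioo_rpow {s : ℝ} (hs : 0 < s) {R : ℝ} (hR : 0 < R) :
    ∫⁻ t in Ioo 0 R, ENNReal.ofReal |t| ^ (s - 1) = ENNReal.ofReal (R ^ s / s) := by
  have hi : IntegrableOn (fun t : ℝ => t ^ (s - 1)) (Ioc 0 R) :=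
    (intervalIntegrable_iff_integrableOn_Ioc_of_le hR.le).1
      (intervalIntegral.intervalIntegrable_rpow' (by linarith))
  have hv : ∫ t in Ioc 0 R, t ^ (s - 1) = R ^ s / s := by
    rw [← intervalIntegral.integral_of_le hR.le, integral_rpow (Or.inl (by linarith))]
    simp [Real.zero_rpow hs.ne']
  rw [setLIntegral_congr Ioo_ae_eq_Ioc, ← hv, ofReal_integral_eq_lintegral_ofReal hi]
  · refine setLIntegral_congr_fun measurableSet_Ioc fun t ht => ?_
    rw [abs_of_pos ht.1, ENNReal.ofReal_rpow_of_pos ht.1]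
  · exact (ae_restrict_mem measurableSet_Ioc).mono fun t ht => Real.rpow_nonneg ht.1.le _

lemma lintegral_Ioo_add_rpow_le {s : ℝ} (hs : s ∈ Ioo (0 : ℝ) 1) {R : ℝ} (hR : 0 < R) (c : ℝ) :
    ∫⁻ t in Ioo 0 R, ENNReal.ofReal |c + t| ^ (s - 1) ≤ ENNReal.ofReal ((2 / s + 1) * R ^ s) := by
  set p : ℝ → ENNReal := fun t => ENNReal.ofReal |t| ^ (s - 1) with hp
  have hpm : Measurable p := measurable_ofReal_abs_rpow _
  set A : ℝ → ENNReal := (Ioo 0 R).indicator p with hA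
  have hAm : Measurable A := hpm.indicator measurableSet_Ioo
  have hAint : ∫⁻ t, A t = ENNReal.ofReal (R ^ s / s) := by
    rw [lintegral_indicator measurableSet_Ioo, lintegral_Ioo_rpow hs.1 hR]
  -- Splitting at `|t| = R` makes the bound uniform in the shift `c`: the singular pieces have
  -- translation-invariant total mass, and the rest is a constant.
  have hpt : ∀ t : ℝ, t ≠ 0 → p t ≤ A t + A (-t) + ENNReal.ofReal (R ^ (s - 1)) := by
    intro t ht
    rcases lt_or_ge |t| R with h | h
    · rcases ht.lt_or_gt with h0 | h0
      · have : A (-t) = p t := by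
          rw [hA, indicator_of_mem (show -t ∈ Ioo 0 R from
            ⟨by linarith, by rwa [abs_of_neg h0] at h⟩)]
          simp [hp]
        rw [this, add_right_comm]; exact le_add_self
      · have : A t = p t := by
          rw [hA, indicator_of_mem (show t ∈ Ioo 0 R from ⟨h0, by rwa [abs_of_pos h0] at h⟩)]
        rw [this, add_assoc]; exact le_self_add
    · refine le_trans ?_ le_add_self
      have h0 : 0 < |t| := abs_pos.2 ht
      simp only [hp]
      rw [ENNReal.ofReal_rpow_of_pos h0]
      exact ENNReal.ofReal_le_ofReal (Real.rpow_le_rpow_of_nonpos hR h (by linarith [hs.2]))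
  have hae : ∀ᵐ t ∂(volume.restrict (Ioo 0 R)), p (c + t) ≤
      A (c + t) + A (-(c + t)) + ENNReal.ofReal (R ^ (s - 1)) := by
    refine ae_restrict_of_ae ?_
    filter_upwards [Measure.ae_ne volume (-c)] with t ht
    exact hpt _ fun h => ht (by linarith)
  refine (lintegral_mono_ae hae).trans ?_
  have m1 : Measurable fun t => A (c + t) := hAm.comp (measurable_const_add c)
  have m2 : Measurable fun t => A (-(c + t)) := hAm.comp (measurable_const_add c).neg
  rw [lintegral_add_right _ measurable_const, lintegral_add_left m1, setLIntegral_const,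
    Real.volume_Ioo, sub_zero]
  have i1 : ∫⁻ t in Ioo 0 R, A (c + t) ≤ ENNReal.ofReal (R ^ s / s) :=
    (setLIntegral_le_lintegral _ _).trans
      (by rw [lintegral_add_left_eq_self A c, hAint])
  have i2 : ∫⁻ t in Ioo 0 R, A (-(c + t)) ≤ ENNReal.ofReal (R ^ s / s) :=
    (setLIntegral_le_lintegral _ _).trans
      (by rw [lintegral_add_left_eq_self (fun t => A (-t)) c, lintegral_neg_eq_self A, hAint])
  refine (add_le_add (add_le_add i1 i2) le_rfl).trans ?_
  have h0 := hs.1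
  have e : R ^ (s - 1) * R = R ^ s := by rw [← Real.rpow_add_one hR.ne']; congr 1; ring
  rw [← ENNReal.ofReal_mul (by positivity), ← ENNReal.ofReal_add (by positivity) (by positivity),
    ← ENNReal.ofReal_add (by positivity) (by positivity), e]
  refine ENNReal.ofReal_le_ofReal (le_of_eq ?_)
  ring

/-- If the integrals of `f` over balls of radius `R` decay like `R ^ γ`, then `‖y‖ ^ (-β) * f` is
integrable near the origin for `β < γ`, with uniform bounds. -/
lemma exists_lintegral_closedBall_rpow_mul_le {E : Type*} [NormedAddCommGroup E]
    [MeasurableSpace E] [BorelSpace E] (μ : Measure E) [NullSingletonClass μ] {β γ r₀ : ℝ}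
    (hβγ : β < γ) (hr₀ : 0 < r₀) :
    ∃ B : ENNReal, B ≠ ⊤ ∧ ∀ (f : E → ENNReal) (A : ENNReal),
      (∀ R ∈ Ioc 0 r₀, ∫⁻ y in closedBall 0 R, f y ∂μ ≤ A * ENNReal.ofReal (R ^ γ)) →
      ∫⁻ y in closedBall 0 r₀, ENNReal.ofReal (‖y‖ ^ (-β)) * f y ∂μ ≤ A * B := by
  set q : ℝ := (1 / 2) ^ (γ - β) with hq
  have hq0 : 0 < q := by positivity
  have hq1 : q < 1 := Real.rpow_lt_one (by norm_num) (by norm_num) (by linarith)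
  set K : ℝ := 2 ^ |β| * r₀ ^ (γ - β) with hK
  have hK0 : 0 < K := by positivity
  refine ⟨∑' k : ℕ, ENNReal.ofReal (K * q ^ k), ?_, fun f A hf => ?_⟩
  · have hsum : Summable fun k : ℕ => K * q ^ k :=
      (summable_geometric_of_lt_one hq0.le hq1).mul_left K
    rw [← ENNReal.ofReal_tsum_of_nonneg (fun k => by positivity) hsum]
    exact ENNReal.ofReal_ne_top
  -- On each dyadic annulus the weight is comparable to a constant, so the annuli contribute a
  -- geometric series of ratio `q`, with `q < 1` because `β < γ`.
  set S : ℕ → Set E := fun k =>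
    {y | (1 / 2) ^ (k + 1) * r₀ < ‖y‖} ∩ closedBall 0 ((1 / 2) ^ k * r₀) with hS
  have hcover : closedBall (0 : E) r₀ \ {0} ⊆ ⋃ k, S k := by
    rintro y ⟨hy, hy0⟩
    have hyn : 0 < ‖y‖ := norm_pos_iff.2 hy0
    rw [mem_closedBall_zero_iff] at hy
    obtain ⟨k, hk1, hk2⟩ := exists_nat_pow_near_of_lt_one (x := ‖y‖ / r₀) (y := (1 / 2 : ℝ))
      (by positivity) ((div_le_one hr₀).2 hy) (by norm_num) (by norm_num)
    refine mem_iUnion.2 ⟨k, ?_, ?_⟩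
    · exact (lt_div_iff₀ hr₀).1 hk1
    · rw [mem_closedBall_zero_iff]; exact (div_le_iff₀ hr₀).1 hk2
  calc ∫⁻ y in closedBall 0 r₀, ENNReal.ofReal (‖y‖ ^ (-β)) * f y ∂μ
      = ∫⁻ y in closedBall 0 r₀ \ {0}, ENNReal.ofReal (‖y‖ ^ (-β)) * f y ∂μ :=
        (setLIntegral_congr (sdiff_null_ae_eq_self (measure_singleton 0))).symm
    _ ≤ ∫⁻ y in ⋃ k, S k, ENNReal.ofReal (‖y‖ ^ (-β)) * f y ∂μ := lintegral_mono_set hcover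
    _ ≤ ∑' k, ∫⁻ y in S k, ENNReal.ofReal (‖y‖ ^ (-β)) * f y ∂μ := lintegral_iUnion_le _ _
    _ ≤ ∑' k, A * ENNReal.ofReal (K * q ^ k) := by
        refine ENNReal.tsum_le_tsum fun k => ?_
        set ρ : ℝ := (1 / 2) ^ k * r₀ with hρ
        have hρ0 : 0 < ρ := by positivity
        have hρ1 : ρ ≤ r₀ := by
          have : (1 / 2 : ℝ) ^ k ≤ 1 := pow_le_one₀ (by norm_num) (by norm_num)
          nlinarith
        have hmS : MeasurableSet (S k) :=
          (measurableSet_lt measurable_const measurable_norm).inter measurableSet_closedBall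
        have hw : ∀ y ∈ S k, ‖y‖ ^ (-β) ≤ 2 ^ |β| * ρ ^ (-β) := by
          rintro y ⟨hy1, hy2⟩
          rw [mem_closedBall_zero_iff] at hy2
          have hy1' : ρ / 2 < ‖y‖ := by
            have : (1 / 2 : ℝ) ^ (k + 1) * r₀ = ρ / 2 := by rw [hρ, pow_succ]; ring
            rw [← this]; exact hy1
          rcases le_total β 0 with hb | hb
          · rw [abs_of_nonpos hb]
            calc ‖y‖ ^ (-β) ≤ ρ ^ (-β) :=
                  Real.rpow_le_rpow (norm_nonneg _) hy2 (by linarith)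
              _ ≤ 2 ^ (-β) * ρ ^ (-β) :=
                  le_mul_of_one_le_left (by positivity)
                    (Real.one_le_rpow (by norm_num) (by linarith))
          · rw [abs_of_nonneg hb]
            calc ‖y‖ ^ (-β) ≤ (ρ / 2) ^ (-β) :=
                  Real.rpow_le_rpow_of_nonpos (by positivity) hy1'.le (by linarith)
              _ = 2 ^ β * ρ ^ (-β) := by
                  rw [Real.div_rpow hρ0.le (by norm_num), Real.rpow_neg zero_le_two,
                    div_inv_eq_mul, mul_comm]
        calc ∫⁻ y in S k, ENNReal.ofReal (‖y‖ ^ (-β)) * f y ∂μ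
            ≤ ∫⁻ y in S k, ENNReal.ofReal (2 ^ |β| * ρ ^ (-β)) * f y ∂μ :=
              setLIntegral_mono' hmS fun y hy =>
                mul_le_mul_left (ENNReal.ofReal_le_ofReal (hw y hy)) _
          _ ≤ ∫⁻ y in closedBall 0 ρ, ENNReal.ofReal (2 ^ |β| * ρ ^ (-β)) * f y ∂μ :=
              lintegral_mono_set inter_subset_right
          _ = ENNReal.ofReal (2 ^ |β| * ρ ^ (-β)) * ∫⁻ y in closedBall 0 ρ, f y ∂μ :=
              lintegral_const_mul' _ _ ENNReal.ofReal_ne_top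
          _ ≤ ENNReal.ofReal (2 ^ |β| * ρ ^ (-β)) * (A * ENNReal.ofReal (ρ ^ γ)) := by
              gcongr; exact hf ρ ⟨hρ0, hρ1⟩
          _ = A * ENNReal.ofReal (K * q ^ k) := by
              rw [mul_left_comm, ← ENNReal.ofReal_mul (by positivity)]
              congr 2
              rw [mul_assoc, ← Real.rpow_add hρ0, hρ, Real.mul_rpow (by positivity) hr₀.le,
                hK, hq, ← Real.rpow_natCast (1 / 2) k, ← Real.rpow_mul (by norm_num),
                ← Real.rpow_natCast (_ ^ (γ - β)) k, ← Real.rpow_mul (by norm_num),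
                mul_comm (k : ℝ), neg_add_eq_sub]
              ring
    _ = A * ∑' k, ENNReal.ofReal (K * q ^ k) := ENNReal.tsum_mul_left

section Haar

variable {E : Type*} [NormedAddCommGroup E] [NormedSpace ℝ E] [MeasurableSpace E] [BorelSpace E]
  [FiniteDimensional ℝ E]

/-- A slab estimate: a negative power `> -1` of the distance to an affine hyperplane. -/
lemma lintegral_closedBall_affine_rpow_le (μ : Measure E) [μ.IsAddHaarMeasure] {s : ℝ}
    (hs : s ∈ Ioo (0 : ℝ) 1) (g : E →L[ℝ] ℝ) {e : E} (he : ‖e‖ ≤ 1) (hge : g e = 1) (c : ℝ)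
    {R : ℝ} (hR : 0 < R) :
    ∫⁻ y in closedBall 0 R, ENNReal.ofReal |c + g y| ^ (s - 1) ∂μ ≤
      ENNReal.ofReal ((2 / s + 1) * 2 ^ Module.finrank ℝ E) * μ (closedBall 0 1) *
        ENNReal.ofReal (R ^ ((Module.finrank ℝ E : ℝ) + s - 1)) := by
  set f : E → ENNReal := fun y => ENNReal.ofReal |c + g y| ^ (s - 1) with hf
  have hfm : Measurable f :=
    (measurable_ofReal_abs_rpow (s - 1)).comp (g.continuous.measurable.const_add c)
  set N := Module.finrank ℝ E
  have hs0 := hs.1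
  have h1 : ∀ τ ∈ Ioo 0 R, ∫⁻ y in closedBall 0 R, f y ∂μ ≤
      ∫⁻ y in closedBall 0 (2 * R), f (y + τ • e) ∂μ := by
    intro τ hτ
    rw [← lintegral_indicator measurableSet_closedBall,
      ← lintegral_indicator measurableSet_closedBall,
      ← lintegral_add_right_eq_self _ (τ • e)]
    refine lintegral_mono fun y => ?_
    by_cases hy : y + τ • e ∈ closedBall (0 : E) R
    · have hy2 : y ∈ closedBall (0 : E) (2 * R) := by
        rw [mem_closedBall_zero_iff] at hy ⊢
        have h : ‖τ • e‖ ≤ R := by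
          rw [norm_smul, Real.norm_of_nonneg hτ.1.le]
          nlinarith [hτ.1, hτ.2, norm_nonneg e]
        calc ‖y‖ = ‖(y + τ • e) - τ • e‖ := by rw [add_sub_cancel_right]
          _ ≤ ‖y + τ • e‖ + ‖τ • e‖ := norm_sub_le _ _
          _ ≤ 2 * R := by linarith
      rw [indicator_of_mem hy, indicator_of_mem hy2]
    · rw [indicator_of_notMem hy]; exact zero_le
  have hfe : ∀ y τ, f (y + τ • e) = ENNReal.ofReal |(c + g y) + τ| ^ (s - 1) := by
    intro y τ
    simp only [hf, map_add, map_smul, hge, smul_eq_mul, mul_one, add_assoc]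
  -- Averaging over the translations `τ • e`, `0 < τ < R`, and exchanging the integrals reduces the
  -- slab estimate to one dimension without choosing coordinates. The price is the doubled ball.
  have h2 : (∫⁻ y in closedBall 0 R, f y ∂μ) * ENNReal.ofReal R ≤
      ENNReal.ofReal ((2 / s + 1) * R ^ s) * μ (closedBall 0 (2 * R)) := by
    calc (∫⁻ y in closedBall 0 R, f y ∂μ) * ENNReal.ofReal R
        = ∫⁻ _ in Ioo (0 : ℝ) R, (∫⁻ y in closedBall 0 R, f y ∂μ) := by
          rw [setLIntegral_const, Real.volume_Ioo, sub_zero]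
      _ ≤ ∫⁻ τ in Ioo (0 : ℝ) R, (∫⁻ y in closedBall 0 (2 * R), f (y + τ • e) ∂μ) :=
          setLIntegral_mono' measurableSet_Ioo h1
      _ = ∫⁻ y in closedBall 0 (2 * R), (∫⁻ τ in Ioo (0 : ℝ) R, f (y + τ • e)) ∂μ := by
          refine lintegral_lintegral_swap (Measurable.aemeasurable ?_)
          refine hfm.comp ?_
          exact (continuous_snd.add (continuous_fst.smul continuous_const)).measurable
      _ ≤ ∫⁻ _ in closedBall 0 (2 * R), ENNReal.ofReal ((2 / s + 1) * R ^ s) ∂μ := by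
          refine lintegral_mono fun y => ?_
          simp only [hfe]
          exact lintegral_Ioo_add_rpow_le hs hR _
      _ = _ := by rw [setLIntegral_const]
  have hRtop : ENNReal.ofReal R ≠ ⊤ := ENNReal.ofReal_ne_top
  have hR0 : ENNReal.ofReal R ≠ 0 := by simpa using hR
  rw [← ENNReal.mul_le_mul_iff_left hR0 hRtop]
  refine h2.trans (le_of_eq ?_)
  have ev : μ (closedBall (0 : E) (2 * R)) =
      ENNReal.ofReal ((2 * R) ^ N) * μ (closedBall 0 1) := by
    rw [Measure.addHaar_closedBall' μ 0 (by positivity)]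
  have eR : (2 / s + 1) * R ^ s * (2 * R) ^ N =
      (2 / s + 1) * 2 ^ N * R ^ ((N : ℝ) + s - 1) * R := by
    have : R ^ ((N : ℝ) + s - 1) * R = R ^ s * R ^ N := by
      rw [← Real.rpow_add_one hR.ne', ← Real.rpow_natCast R N, ← Real.rpow_add hR]
      congr 1; ring
    rw [mul_assoc _ _ R, this, mul_pow]; ring
  rw [ev, ← mul_assoc, ← ENNReal.ofReal_mul (by positivity), eR,
    ENNReal.ofReal_mul (by positivity), ENNReal.ofReal_mul (by positivity)]
  ring

/-- The tail of a kernel of order `2 s` is integrable against functions of growth `s`. -/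
lemma lintegral_compl_closedBall_lt_top (μ : Measure E) [μ.IsAddHaarMeasure] {s r₀ : ℝ}
    (hs : 0 < s) (hr₀ : 0 < r₀) :
    ∫⁻ y in (closedBall (0 : E) r₀)ᶜ, ENNReal.ofReal
      (‖y‖ ^ (-((Module.finrank ℝ E : ℝ) + 2 * s)) * (1 + ‖y‖) ^ s) ∂μ < ⊤ := by
  set N := Module.finrank ℝ E
  have hi : Integrable (fun y : E => ((1 + r₀) / r₀) ^ ((N : ℝ) + 2 * s) *
      (1 + ‖y‖) ^ (-((N : ℝ) + s))) μ :=
    (integrable_one_add_norm (by linarith)).const_mul _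
  have hlt := hi.lintegral_lt_top
  refine lt_of_le_of_lt ?_ hlt
  refine (setLIntegral_mono' measurableSet_closedBall.compl fun y hy => ?_).trans
    (setLIntegral_le_lintegral _ _)
  refine ENNReal.ofReal_le_ofReal ?_
  have hy' : r₀ < ‖y‖ := by simpa using hy
  have hy0 : 0 < ‖y‖ := hr₀.trans hy'
  have h1 : 0 < 1 + ‖y‖ := by linarith
  have key : ‖y‖ ^ (-((N : ℝ) + 2 * s)) ≤
      ((1 + r₀) / r₀) ^ ((N : ℝ) + 2 * s) * (1 + ‖y‖) ^ (-((N : ℝ) + 2 * s)) := by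
    have hle : (1 + ‖y‖) / ((1 + r₀) / r₀) ≤ ‖y‖ := by
      rw [div_le_iff₀ (by positivity), mul_div_assoc', le_div_iff₀ hr₀]
      nlinarith
    calc ‖y‖ ^ (-((N : ℝ) + 2 * s)) ≤ ((1 + ‖y‖) / ((1 + r₀) / r₀)) ^ (-((N : ℝ) + 2 * s)) :=
          Real.rpow_le_rpow_of_nonpos (by positivity) hle (by
            have : (0 : ℝ) ≤ N := Nat.cast_nonneg _
            linarith)
      _ = _ := by
          rw [Real.div_rpow h1.le (by positivity),
            Real.rpow_neg (by positivity : 0 ≤ (1 + r₀) / r₀), div_inv_eq_mul, mul_comm]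
  calc ‖y‖ ^ (-((N : ℝ) + 2 * s)) * (1 + ‖y‖) ^ s
      ≤ ((1 + r₀) / r₀) ^ ((N : ℝ) + 2 * s) * (1 + ‖y‖) ^ (-((N : ℝ) + 2 * s)) * (1 + ‖y‖) ^ s := by
        gcongr
    _ = ((1 + r₀) / r₀) ^ ((N : ℝ) + 2 * s) * (1 + ‖y‖) ^ (-((N : ℝ) + s)) := by
        rw [mul_assoc, ← Real.rpow_add h1]; congr 2; ring

end Haar

/-! ### Comparison of `s`-th powers. -/

/-- By homogeneity take `b = 1`; then `a^s` lies between `1` and `a`. The singular factor involves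
`b` alone, so `a` may vanish. -/
lemma abs_rpow_sub_rpow_le {s : ℝ} (hs : s ∈ Ioo (0 : ℝ) 1) {a b : ℝ} (ha : 0 ≤ a) (hb : 0 < b) :
    |a ^ s - b ^ s| ≤ |a - b| * b ^ (s - 1) := by
  have hq : 0 ≤ a / b := by positivity
  have h1 : |(a / b) ^ s - 1| ≤ |a / b - 1| := by
    rcases le_total (a / b) 1 with h | h
    · have h2 : (a / b) ^ s ≤ 1 := Real.rpow_le_one hq h hs.1.le
      have h3 : a / b ≤ (a / b) ^ s := by
        rcases hq.eq_or_lt with h0 | h0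
        · rw [← h0, Real.zero_rpow hs.1.ne']
        · simpa using Real.rpow_le_rpow_of_exponent_ge h0 h hs.2.le
      rw [abs_of_nonpos (by linarith), abs_of_nonpos (by linarith)]
      linarith
    · have h2 : 1 ≤ (a / b) ^ s := Real.one_le_rpow h hs.1.le
      have h3 : (a / b) ^ s ≤ a / b := by
        simpa using Real.rpow_le_rpow_of_exponent_le h hs.2.le
      rw [abs_of_nonneg (by linarith), abs_of_nonneg (by linarith)]
      linarith
  have hbs : 0 < b ^ s := Real.rpow_pos_of_pos hb s
  rw [Real.div_rpow ha hb.le] at h1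
  have e1 : |a ^ s - b ^ s| = |a ^ s / b ^ s - 1| * b ^ s := by
    rw [div_sub_one hbs.ne', abs_div, abs_of_pos hbs, div_mul_cancel₀ _ hbs.ne']
  have e2 : |a - b| * b ^ (s - 1) = |a / b - 1| * b ^ s := by
    rw [div_sub_one hb.ne', abs_div, abs_of_pos hb, Real.rpow_sub_one hb.ne']; ring
  rw [e1, e2]
  exact mul_le_mul_of_nonneg_right h1 hbs.le

/-- Here `a` plays the distance and `b` its Taylor polynomial. If `b < 0` and `|a - b| ≤ ε`, then
`a` and `-b` are both at most `ε`, whence `a^s ≤ ε · ε^(s-1) ≤ ε |b|^(s-1)`. Where `a = 0` an upper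
bound on `b` is enough, since a negative `b` is cut off. At `b = 0` the right side is `⊤`. -/
lemma ofReal_abs_rpow_sub_max_rpow_le {s : ℝ} (hs : s ∈ Ioo (0 : ℝ) 1) {a b ε : ℝ} (ha : 0 ≤ a)
    (hε : 0 < ε) (h : |a - b| ≤ ε ∨ a = 0 ∧ b ≤ ε) :
    ENNReal.ofReal |a ^ s - max b 0 ^ s| ≤ ENNReal.ofReal ε * ENNReal.ofReal |b| ^ (s - 1) := by
  rcases eq_or_ne b 0 with rfl | hb
  · rw [abs_zero, ENNReal.ofReal_zero, ENNReal.zero_rpow_of_neg (by linarith [hs.2]),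
      ENNReal.mul_top (by simpa using hε)]
    exact le_top
  rw [ENNReal.ofReal_rpow_of_pos (abs_pos.2 hb), ← ENNReal.ofReal_mul hε.le]
  refine ENNReal.ofReal_le_ofReal ?_
  rcases hb.lt_or_gt with hb0 | hb0
  · rw [max_eq_right hb0.le, Real.zero_rpow hs.1.ne', sub_zero]
    rcases h with h | ⟨rfl, _⟩
    · rw [abs_of_nonneg (by linarith)] at h
      rw [abs_of_nonneg (Real.rpow_nonneg ha _), abs_of_neg hb0]
      calc a ^ s ≤ ε ^ s := Real.rpow_le_rpow ha (by linarith) hs.1.le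
        _ = ε * ε ^ (s - 1) := by rw [Real.rpow_sub_one hε.ne']; field_simp
        _ ≤ ε * (-b) ^ (s - 1) := by
            refine mul_le_mul_of_nonneg_left ?_ hε.le
            exact Real.rpow_le_rpow_of_nonpos (by linarith) (by linarith) (by linarith [hs.2])
    · rw [Real.zero_rpow hs.1.ne', abs_zero]; positivity
  · rw [max_eq_left hb0.le, abs_of_pos hb0]
    refine (abs_rpow_sub_rpow_le hs ha hb0).trans
      (mul_le_mul_of_nonneg_right ?_ (Real.rpow_nonneg hb0.le _))
    rcases h with h | ⟨rfl, h⟩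
    · exact h
    · rwa [zero_sub, abs_neg, abs_of_pos hb0]

/-! ### Functions with Hölder continuous differential. -/

section HolderGradient

variable {E : Type*} [NormedAddCommGroup E] [NormedSpace ℝ E] {α : ℝ} {S : Set E} {f : E → ℝ}

lemma IsC1Holder.exists_nonneg (h : IsC1Holder α S f) : ∃ K : ℝ, 0 ≤ K ∧
    ∀ x ∈ S, ∀ y ∈ S, ‖fderiv ℝ f x - fderiv ℝ f y‖ ≤ K * ‖x - y‖ ^ α := by
  obtain ⟨K, hK⟩ := h.2
  refine ⟨max K 0, le_max_right _ _, fun x hx y hy => (hK x hx y hy).trans ?_⟩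
  exact mul_le_mul_of_nonneg_right (le_max_left _ _) (Real.rpow_nonneg (norm_nonneg _) _)

lemma IsC1Holder.mono {T : Set E} (h : IsC1Holder α S f) (hT : T ⊆ S) : IsC1Holder α T f :=
  ⟨fun x hx => h.1 x (hT hx), h.2.imp fun _ hK x hx y hy => hK x (hT hx) y (hT hy)⟩

lemma IsC1Holder.exists_norm_fderiv_le (h : IsC1Holder α S f) (hα : 0 ≤ α)
    (hS : Bornology.IsBounded S) : ∃ M : ℝ, 0 ≤ M ∧ ∀ x ∈ S, ‖fderiv ℝ f x‖ ≤ M := by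
  rcases S.eq_empty_or_nonempty with rfl | ⟨x₀, hx₀⟩
  · exact ⟨0, le_rfl, by simp⟩
  obtain ⟨K, hK0, hK⟩ := h.exists_nonneg
  obtain ⟨D, hD⟩ := Metric.isBounded_iff.1 hS
  have hD0 : 0 ≤ D := dist_nonneg.trans (hD hx₀ hx₀)
  refine ⟨‖fderiv ℝ f x₀‖ + K * D ^ α, by positivity, fun x hx => ?_⟩
  have h1 : ‖fderiv ℝ f x - fderiv ℝ f x₀‖ ≤ K * D ^ α := by
    refine (hK x hx x₀ hx₀).trans (mul_le_mul_of_nonneg_left ?_ hK0)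
    refine Real.rpow_le_rpow (norm_nonneg _) ?_ hα
    rw [← dist_eq_norm]; exact hD hx hx₀
  calc ‖fderiv ℝ f x‖ = ‖fderiv ℝ f x₀ + (fderiv ℝ f x - fderiv ℝ f x₀)‖ := by
        rw [add_sub_cancel]
    _ ≤ _ := (norm_add_le _ _).trans (by linarith)

/-- First-order Taylor estimate along a segment, with the differential taken at a nearby point. -/
lemma abs_sub_sub_fderiv_le_of_segment (hd : ∀ x ∈ S, DifferentiableAt ℝ f x) {K : ℝ}
    (hK0 : 0 ≤ K) (hα : 0 ≤ α)
    (hK : ∀ x ∈ S, ∀ y ∈ S, ‖fderiv ℝ f x - fderiv ℝ f y‖ ≤ K * ‖x - y‖ ^ α)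
    {x₀ a b : E} (hx₀ : x₀ ∈ S) (hab : segment ℝ a b ⊆ S) {D : ℝ} (ha : ‖a - x₀‖ ≤ D)
    (hb : ‖b - x₀‖ ≤ D) :
    |f b - f a - fderiv ℝ f x₀ (b - a)| ≤ K * D ^ α * ‖b - a‖ := by
  rw [← Real.norm_eq_abs]
  refine (convex_segment a b).norm_image_sub_le_of_norm_hasFDerivWithin_le'
    (f' := fderiv ℝ f) (fun w hw => (hd w (hab hw)).hasFDerivAt.hasFDerivWithinAt)
    (fun w hw => ?_) (left_mem_segment ℝ a b) (right_mem_segment ℝ a b)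
  refine (hK w (hab hw) x₀ hx₀).trans (mul_le_mul_of_nonneg_left ?_ hK0)
  refine Real.rpow_le_rpow (norm_nonneg _) ?_ hα
  have h := (convex_closedBall x₀ D).segment_subset (mem_closedBall_iff_norm.2 ha)
    (mem_closedBall_iff_norm.2 hb) hw
  exact mem_closedBall_iff_norm.1 h

end HolderGradient

/-! ### Continuity, boundedness and gradient of the distance function. -/

section DistanceFunction

variable {n : ℕ} {α : ℝ} {Ω : Set (EuclideanSpace ℝ (Fin n))} {d : EuclideanSpace ℝ (Fin n) → ℝ}

lemma IsDistanceFunction.nonneg (h : IsDistanceFunction α Ω d) (x : EuclideanSpace ℝ (Fin n)) :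
    0 ≤ d x := by
  by_cases hx : x ∈ Ω
  · exact (h.pos x hx).le
  · exact (h.eq_zero x hx).ge

lemma IsDistanceFunction.continuous (h : IsDistanceFunction α Ω d) (hΩ : IsOpen Ω) :
    Continuous d := by
  rw [continuous_iff_continuousAt]
  intro x
  by_cases hx : x ∈ Ω
  · exact (h.isC1Holder.1 x hx).continuousAt
  by_cases hx' : x ∈ closure Ω
  · obtain ⟨U, hU, hfU, hdU⟩ := h.eq_infDist
    have hxU : x ∈ U := hfU ⟨hx', by rwa [hΩ.interior_eq]⟩
    have : (fun y => infDist y Ωᶜ) =ᶠ[𝓝 x] d :=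
      Filter.eventuallyEq_of_mem (hU.mem_nhds hxU) fun y hy => (hdU y hy).symm
    exact (continuous_infDist_pt _).continuousAt.congr this
  · have : (fun _ => (0 : ℝ)) =ᶠ[𝓝 x] d :=
      Filter.eventuallyEq_of_mem (isClosed_closure.isOpen_compl.mem_nhds hx') fun y hy =>
        (h.eq_zero y fun hy' => hy (subset_closure hy')).symm
    exact continuousAt_const.congr this

lemma IsDistanceFunction.exists_le (h : IsDistanceFunction α Ω d) (hΩ : IsOpen Ω)
    (hb : Bornology.IsBounded Ω) : ∃ B : ℝ, 0 ≤ B ∧ ∀ x, d x ≤ B := by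
  obtain ⟨B, hB⟩ := hb.isCompact_closure.exists_bound_of_continuousOn (h.continuous hΩ).continuousOn
  refine ⟨max B 0, le_max_right _ _, fun x => ?_⟩
  by_cases hx : x ∈ Ω
  · exact ((le_abs_self _).trans (hB x (subset_closure hx))).trans (le_max_left _ _)
  · rw [h.eq_zero x hx]; exact le_max_right _ _

/-- Where the distance to a closed set is positive and differentiable, its gradient has norm at
least one. -/
lemma one_le_norm_fderiv_of_eventuallyEq_infDist {E : Type*} [NormedAddCommGroup E]
    [NormedSpace ℝ E] [ProperSpace E] {F : Set E} (hF : IsClosed F) {f : E → ℝ} {x : E}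
    (hf : f =ᶠ[𝓝 x] fun y => infDist y F) (hd : DifferentiableAt ℝ f x) (hx : 0 < f x) :
    1 ≤ ‖fderiv ℝ f x‖ := by
  have hfx : f x = infDist x F := hf.self_of_nhds
  have hne : F.Nonempty := by
    rw [nonempty_iff_ne_empty]
    rintro rfl
    rw [hfx, infDist_empty] at hx
    exact lt_irrefl _ hx
  obtain ⟨p, hpF, hp⟩ := hF.exists_infDist_eq_dist hne x
  have hD : ‖p - x‖ = f x := by rw [hfx, hp, dist_comm, dist_eq_norm]
  have hl : HasDerivAt (fun t : ℝ => x + t • (p - x)) (p - x) 0 := by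
    simpa using ((hasDerivAt_id (0 : ℝ)).smul_const (p - x)).const_add x
  have hder : HasDerivAt (fun t : ℝ => f (x + t • (p - x))) (fderiv ℝ f x (p - x)) 0 := by
    have h0 : HasFDerivAt f (fderiv ℝ f x) (x + (0 : ℝ) • (p - x)) := by simpa using hd.hasFDerivAt
    exact h0.comp_hasDerivAt 0 hl
  have hev : ∀ᶠ t : ℝ in 𝓝[>] 0, f (x + t • (p - x)) = infDist (x + t • (p - x)) F := by
    have hc : Filter.Tendsto (fun t : ℝ => x + t • (p - x)) (𝓝[>] 0) (𝓝 x) := by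
      have := hl.continuousAt.tendsto
      simp only [zero_smul, add_zero] at this
      exact this.mono_left nhdsWithin_le_nhds
    exact hc.eventually hf
  -- Moving towards a nearest point `p` decreases the distance at unit rate.
  have hle : fderiv ℝ f x (p - x) ≤ -f x := by
    refine le_of_tendsto hder.tendsto_slope_zero_right ?_
    filter_upwards [hev, Ioo_mem_nhdsGT (zero_lt_one' ℝ)] with t ht ht1
    simp only [zero_add, zero_smul, add_zero, smul_eq_mul]
    rw [ht, inv_mul_le_iff₀ ht1.1]
    have h1 : infDist (x + t • (p - x)) F ≤ (1 - t) * f x := by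
      refine (infDist_le_dist_of_mem hpF).trans (le_of_eq ?_)
      rw [dist_eq_norm, ← hD, show x + t • (p - x) - p = (t - 1) • (p - x) by module, norm_smul,
        Real.norm_eq_abs, abs_of_nonpos (by linarith [ht1.2])]
      ring
    linarith
  have hop := (fderiv ℝ f x).le_opNorm (p - x)
  rw [hD, Real.norm_eq_abs] at hop
  have := neg_abs_le (fderiv ℝ f x (p - x))
  by_contra hlt
  nlinarith

/-- The part of `closure Ω` outside the neighbourhood `U` is compact and contained in `Ω`, so `d`
has a positive minimum there. Points of `Ω` below this value lie in `U`, where `d` is the true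
distance. -/
lemma IsDistanceFunction.exists_one_le_norm_fderiv (h : IsDistanceFunction α Ω d) (hΩ : IsOpen Ω)
    (hb : Bornology.IsBounded Ω) : ∃ δ : ℝ, 0 < δ ∧ ∀ x ∈ Ω, d x < δ → 1 ≤ ‖fderiv ℝ d x‖ := by
  obtain ⟨U, hU, hfU, hdU⟩ := h.eq_infDist
  have key : ∀ x ∈ Ω, x ∈ U → 1 ≤ ‖fderiv ℝ d x‖ := fun x hx hxU =>
    one_le_norm_fderiv_of_eventuallyEq_infDist hΩ.isClosed_compl
      (Filter.eventuallyEq_of_mem (hU.mem_nhds hxU) hdU) (h.isC1Holder.1 x hx) (h.pos x hx)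
  have hc : IsCompact (closure Ω \ U) := hb.isCompact_closure.inter_right hU.isClosed_compl
  have hsub : closure Ω \ U ⊆ Ω := by
    rintro x ⟨hx, hxU⟩
    by_contra hxΩ
    exact hxU (hfU ⟨hx, by rwa [hΩ.interior_eq]⟩)
  rcases (closure Ω \ U).eq_empty_or_nonempty with he | hne
  · refine ⟨1, one_pos, fun x hx _ => key x hx ?_⟩
    by_contra hxU
    have : x ∈ closure Ω \ U := ⟨subset_closure hx, hxU⟩
    rw [he] at this
    exact this
  · obtain ⟨m, hm, hmin⟩ := hc.exists_isMinOn hne (h.continuous hΩ).continuousOn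
    refine ⟨d m, h.pos m (hsub hm), fun x hx hlt => key x hx ?_⟩
    by_contra hxU
    exact absurd (hmin ⟨subset_closure hx, hxU⟩ : d m ≤ d x) (not_le.2 hlt)

end DistanceFunction

/-! ### Cone condition at the boundary. -/

section Domain

variable {n : ℕ} {α : ℝ} {Ω : Set (EuclideanSpace ℝ (Fin n))}

/-- Hölder continuity bounds the differential only on bounded sets, hence the restriction to a ball.
-/
lemma IsC1Holder.exists_lipschitz_ball {F : Type*} [NormedAddCommGroup F] [NormedSpace ℝ F]
    {γ : F → ℝ} (h : IsC1Holder α univ γ) (hα : 0 ≤ α) (z : F) :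
    ∃ G : ℝ, 0 ≤ G ∧ ∀ u ∈ ball z 1, ∀ v ∈ ball z 1, |γ v - γ u| ≤ G * ‖v - u‖ := by
  obtain ⟨G, hG0, hG⟩ := (h.mono (subset_univ (ball z 1))).exists_norm_fderiv_le hα isBounded_ball
  refine ⟨G, hG0, fun u hu v hv => ?_⟩
  exact (convex_ball z 1).norm_image_sub_le_of_norm_fderiv_le (𝕜 := ℝ)
    (fun x _ => h.1 x (mem_univ x)) hG hu hv

/-- Near a boundary point, a `C^{1,α}` domain satisfies a cone condition in some direction `e`,
and vertical lines in this direction enter the domain only once. -/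
lemma IsC1HolderDomain.exists_cone (h : IsC1HolderDomain α Ω) (hα : 0 ≤ α)
    {z : EuclideanSpace ℝ (Fin n)} (hz : z ∈ frontier Ω) :
    ∃ ρ : ℝ, 0 < ρ ∧ ∃ e : EuclideanSpace ℝ (Fin n), ‖e‖ = 1 ∧ ∃ G : ℝ, 0 ≤ G ∧
      (∀ w ∈ ball z ρ, w ∈ Ω → ∀ (q : EuclideanSpace ℝ (Fin n)) (t : ℝ), (G + 1) * ‖q‖ ≤ t →
        w + q + t • e ∈ ball z ρ → w + q + t • e ∈ Ω) ∧
      ∀ x ∈ ball z ρ, x ∉ Ω → ∃ t : ℝ, 0 ≤ t ∧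
        ∀ τ : ℝ, x + τ • e ∈ ball z ρ → (x + τ • e ∈ Ω ↔ t < τ) := by
  obtain ⟨ρ, hρ, e, he, γ, hγ, hiff⟩ := h.2 z hz
  set P := (Submodule.span ℝ {e})ᗮ.orthogonalProjectionOnto with hP
  obtain ⟨G, hG0, hG⟩ := hγ.exists_lipschitz_ball hα (P z)
  have hPe : P e = 0 := by
    rw [hP, Submodule.orthogonalProjectionOnto_eq_zero_iff, Submodule.orthogonal_orthogonal]
    exact Submodule.mem_span_singleton_self e
  have hPn : ∀ v, ‖P v‖ ≤ ‖v‖ := fun v => by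
    simpa using P.le_of_opNorm_le (Submodule.orthogonalProjectionOnto_norm_le _) v
  have hPt : ∀ x (t : ℝ), P (x + t • e) = P x := fun x t => by
    rw [map_add, map_smul, hPe, smul_zero, add_zero]
  have hin : ∀ x (t : ℝ), ⟪x + t • e, e⟫_ℝ = ⟪x, e⟫_ℝ + t := fun x t => by
    rw [inner_add_left, real_inner_smul_left, real_inner_self_eq_norm_sq, he]; ring
  have hPball : ∀ x ∈ ball z (min ρ 1), P x ∈ ball (P z) 1 := fun x hx => by
    rw [mem_ball_iff_norm] at hx ⊢
    rw [← map_sub]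
    exact (hPn _).trans_lt (hx.trans_le (min_le_right _ _))
  have hiff' : ∀ x ∈ ball z (min ρ 1), (x ∈ Ω ↔ γ (P x) < ⟪x, e⟫_ℝ) := fun x hx =>
    hiff x (ball_subset_ball (min_le_left _ _) hx)
  refine ⟨min ρ 1, lt_min hρ one_pos, e, he, G, hG0, ?_, ?_⟩
  · intro w hw hwΩ q t hqt hball
    rw [hiff' _ hball, hPt, hin, inner_add_left]
    have h1 := (hiff' w hw).1 hwΩ
    have h2 : P (w + q) ∈ ball (P z) 1 := by
      have := hPball _ hball
      rwa [hPt] at this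
    have h3 := (abs_le.1 (hG _ (hPball w hw) _ h2)).2
    have h4 : ‖P (w + q) - P w‖ ≤ ‖q‖ := by rw [map_add, add_sub_cancel_left]; exact hPn q
    have h5 : -‖q‖ ≤ ⟪q, e⟫_ℝ := by
      have := abs_le.1 (abs_real_inner_le_norm q e)
      rw [he, mul_one] at this
      exact this.1
    -- In the slope `G + 1`, the part `G` pays for the variation of `γ` and the part `1` for the
    -- vertical component of `q`.
    nlinarith
  · intro x hx hxΩ
    rw [hiff' x hx, not_lt] at hxΩ
    refine ⟨γ (P x) - ⟪x, e⟫_ℝ, by linarith, fun τ hτ => ?_⟩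
    rw [hiff' _ hτ, hPt, hin]
    constructor <;> intro <;> linarith

end Domain

/-! ### Taylor estimates up to and across the boundary. -/

section Taylor

variable {E : Type*} [NormedAddCommGroup E] [NormedSpace ℝ E]

/-- The positive part of the first-order Taylor polynomial of `d` at `x₀` approximates `d` at `x`
up to an error `C * ‖x - x₀‖ ^ (1 + α)`. Outside `Ω` only an upper bound is required. -/
def HasTaylorBound (Ω : Set E) (d : E → ℝ) (α C : ℝ) (x₀ x : E) : Prop :=
  (x ∈ Ω → |d x - (d x₀ + fderiv ℝ d x₀ (x - x₀))| ≤ C * ‖x - x₀‖ ^ (1 + α)) ∧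
    (x ∉ Ω → d x₀ + fderiv ℝ d x₀ (x - x₀) ≤ C * ‖x - x₀‖ ^ (1 + α))

lemma HasTaylorBound.mono {Ω : Set E} {d : E → ℝ} {α C C' : ℝ} {x₀ x : E}
    (h : HasTaylorBound Ω d α C x₀ x) (hC : C ≤ C') : HasTaylorBound Ω d α C' x₀ x := by
  have : C * ‖x - x₀‖ ^ (1 + α) ≤ C' * ‖x - x₀‖ ^ (1 + α) :=
    mul_le_mul_of_nonneg_right hC (Real.rpow_nonneg (norm_nonneg _) _)
  exact ⟨fun hx => (h.1 hx).trans this, fun hx => (h.2 hx).trans this⟩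

lemma exists_eq_add_smul_of_mem_segment {a v w : E} (hw : w ∈ segment ℝ a (a + v)) :
    ∃ t ∈ Icc (0 : ℝ) 1, w = a + t • v := by
  rw [segment_eq_image'] at hw
  obtain ⟨t, ht, rfl⟩ := hw
  exact ⟨t, ht, by simp⟩

/-- Two points of a domain with a cone condition are joined by a path going up, across and down,
along which the Taylor estimate holds. -/
lemma abs_taylor_le_of_cone {Ω : Set E} {d : E → ℝ} {α K : ℝ} (hα : 0 < α) (hK0 : 0 ≤ K)
    (hd : ∀ x ∈ Ω, DifferentiableAt ℝ d x)
    (hK : ∀ x ∈ Ω, ∀ y ∈ Ω, ‖fderiv ℝ d x - fderiv ℝ d y‖ ≤ K * ‖x - y‖ ^ α)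
    {z e : E} {ρ G : ℝ} (he : ‖e‖ = 1) (hG : 0 ≤ G)
    (hcone : ∀ w ∈ ball z ρ, w ∈ Ω → ∀ (q : E) (t : ℝ), (G + 1) * ‖q‖ ≤ t →
        w + q + t • e ∈ ball z ρ → w + q + t • e ∈ Ω)
    {r : ℝ} (hr : r * (2 * G + 5) ≤ ρ) {x₀ x : E}
    (hx₀ : x₀ ∈ Ω) (hx : x ∈ Ω) (hx₀r : x₀ ∈ ball z r) (hxr : x ∈ ball z r) :
    |d x - (d x₀ + fderiv ℝ d x₀ (x - x₀))| ≤
      K * (G + 2) ^ α * (2 * G + 3) * ‖x - x₀‖ ^ (1 + α) := by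
  set δ := ‖x - x₀‖ with hδ
  have hδ0 : 0 ≤ δ := norm_nonneg _
  rw [mem_ball_iff_norm] at hx₀r hxr
  have hr0 : 0 < r := (norm_nonneg _).trans_lt hxr
  have hδr : δ < 2 * r := by
    calc δ = ‖(x - z) - (x₀ - z)‖ := by rw [hδ]; congr 1; abel
      _ ≤ ‖x - z‖ + ‖x₀ - z‖ := norm_sub_le _ _
      _ < 2 * r := by linarith
  -- The least height at which the cone above `x₀` contains the whole horizontal leg. The path stays
  -- within `r + 2r + (G+1)·2r = (2G+5)r` of `z`.
  set h := (G + 1) * δ with hh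
  have hh0 : 0 ≤ h := by positivity
  have hhr : h ≤ (G + 1) * (2 * r) := by rw [hh]; gcongr
  have hxρ : x ∈ ball z ρ := by rw [mem_ball_iff_norm]; nlinarith
  have hx₀ρ : x₀ ∈ ball z ρ := by rw [mem_ball_iff_norm]; nlinarith
  have hte : ∀ t ∈ Icc (0 : ℝ) 1, ‖(t * h) • e‖ ≤ h := fun t ht => by
    rw [norm_smul, he, mul_one, Real.norm_of_nonneg (mul_nonneg ht.1 hh0)]
    exact mul_le_of_le_one_left hh0 ht.2
  have hvert : ∀ w ∈ Ω, ‖w - z‖ < r → segment ℝ w (w + h • e) ⊆ Ω := by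
    intro w hw hwr y hy
    obtain ⟨t, ht, rfl⟩ := exists_eq_add_smul_of_mem_segment hy
    have := hcone w (by rw [mem_ball_iff_norm]; nlinarith) hw 0 (t * h)
      (by rw [norm_zero, mul_zero]; exact mul_nonneg ht.1 hh0)
    rw [add_zero] at this
    rw [smul_smul]
    refine this ?_
    rw [mem_ball_iff_norm, add_sub_right_comm]
    calc ‖w - z + (t * h) • e‖ ≤ ‖w - z‖ + ‖(t * h) • e‖ := norm_add_le _ _
      _ < r + h := add_lt_add_of_lt_of_le hwr (hte t ht)
      _ ≤ ρ := by nlinarith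
  have hhe : ‖h • e‖ = h := by rw [norm_smul, he, mul_one, Real.norm_of_nonneg hh0]
  have hhoriz : segment ℝ (x₀ + h • e) (x + h • e) ⊆ Ω := by
    intro y hy
    rw [show x + h • e = x₀ + h • e + (x - x₀) by abel] at hy
    obtain ⟨t, ht, rfl⟩ := exists_eq_add_smul_of_mem_segment hy
    have hq : ‖t • (x - x₀)‖ ≤ δ := by
      rw [norm_smul, Real.norm_of_nonneg ht.1]
      exact mul_le_of_le_one_left hδ0 ht.2
    have := hcone x₀ hx₀ρ hx₀ (t • (x - x₀)) h (by rw [hh]; gcongr)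
    rw [show x₀ + h • e + t • (x - x₀) = x₀ + t • (x - x₀) + h • e by abel]
    refine this ?_
    rw [mem_ball_iff_norm, show x₀ + t • (x - x₀) + h • e - z = (x₀ - z) + t • (x - x₀) + h • e by
      abel]
    calc ‖(x₀ - z) + t • (x - x₀) + h • e‖ ≤ ‖x₀ - z‖ + ‖t • (x - x₀)‖ + ‖h • e‖ :=
          norm_add₃_le
      _ < r + 2 * r + h := by rw [hhe]; linarith
      _ ≤ ρ := by nlinarith
  have b0 : ‖x₀ - x₀‖ ≤ (G + 2) * δ := by rw [sub_self, norm_zero]; positivity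
  have b1 : ‖x₀ + h • e - x₀‖ ≤ (G + 2) * δ := by
    rw [add_sub_cancel_left, hhe, hh]; gcongr; norm_num
  have b2 : ‖x + h • e - x₀‖ ≤ (G + 2) * δ := by
    rw [add_sub_right_comm]
    refine (norm_add_le _ _).trans (le_of_eq ?_)
    rw [hhe, hh, ← hδ]; ring
  have b3 : ‖x - x₀‖ ≤ (G + 2) * δ := by rw [← hδ]; nlinarith
  have s1 := abs_sub_sub_fderiv_le_of_segment hd hK0 hα.le hK hx₀ (hvert x₀ hx₀ hx₀r) b0 b1
  have s2 := abs_sub_sub_fderiv_le_of_segment hd hK0 hα.le hK hx₀ hhoriz b1 b2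
  have s3 := abs_sub_sub_fderiv_le_of_segment hd hK0 hα.le hK hx₀ (hvert x hx hxr) b3 b2
  rw [add_sub_cancel_left, hhe] at s1 s3
  rw [add_sub_add_right_eq_sub, ← hδ] at s2
  -- The path has length `(2G+3)δ` and stays within `(G+2)δ` of `x₀`; the linear terms of the three
  -- legs telescope.
  have hpow : K * ((G + 2) * δ) ^ α * h + K * ((G + 2) * δ) ^ α * δ + K * ((G + 2) * δ) ^ α * h =
      K * (G + 2) ^ α * (2 * G + 3) * δ ^ (1 + α) := by
    rw [Real.mul_rpow (by positivity) hδ0, Real.rpow_one_add' hδ0 (by linarith), hh]; ring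
  rw [← hpow]
  rw [abs_le] at s1 s2 s3 ⊢
  constructor <;> linarith

/-- At exterior points, the Taylor polynomial is bounded by the Taylor estimate at a point just
above the boundary, since `d` increases there in the direction of the cone. -/
lemma taylor_le_of_cone {Ω : Set E} {d : E → ℝ} {α K : ℝ} (hα : 0 < α) (hK0 : 0 ≤ K)
    (hd : ∀ x ∈ Ω, DifferentiableAt ℝ d x) (hdc : Continuous d) (hdpos : ∀ x ∈ Ω, 0 < d x)
    (hd0 : ∀ x, x ∉ Ω → d x = 0)
    (hK : ∀ x ∈ Ω, ∀ y ∈ Ω, ‖fderiv ℝ d x - fderiv ℝ d y‖ ≤ K * ‖x - y‖ ^ α)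
    {z e : E} {ρ G : ℝ} (he : ‖e‖ = 1) (hG : 0 ≤ G)
    (hcone : ∀ w ∈ ball z ρ, w ∈ Ω → ∀ (q : E) (t : ℝ), (G + 1) * ‖q‖ ≤ t →
        w + q + t • e ∈ ball z ρ → w + q + t • e ∈ Ω)
    (hexit : ∀ x ∈ ball z ρ, x ∉ Ω → ∃ t : ℝ, 0 ≤ t ∧
        ∀ τ : ℝ, x + τ • e ∈ ball z ρ → (x + τ • e ∈ Ω ↔ t < τ))
    {r : ℝ} (hr : r * (2 * G + 5) ≤ ρ) {r' : ℝ} (hr' : r' * (2 * G + 5) ≤ r) {x₀ x : E}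
    (hx₀ : x₀ ∈ Ω) (hx : x ∉ Ω) (hx₀r : x₀ ∈ ball z r') (hxr : x ∈ ball z r') :
    d x₀ + fderiv ℝ d x₀ (x - x₀) ≤
      (1 + K * (G + 2) ^ α * (2 * G + 3) * (G + 3) ^ (1 + α) + (G + 2) * (K * (G + 3) ^ α)) *
        ‖x - x₀‖ ^ (1 + α) := by
  set C₁ := K * (G + 2) ^ α * (2 * G + 3) with hC₁
  have hC₁0 : 0 ≤ C₁ := by positivity
  set δ := ‖x - x₀‖ with hδ
  have hne : x ≠ x₀ := fun h => hx (h ▸ hx₀)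
  have hδ0 : 0 < δ := norm_pos_iff.2 (sub_ne_zero.2 hne)
  rw [mem_ball_iff_norm] at hx₀r hxr
  have hr'0 : 0 < r' := (norm_nonneg _).trans_lt hxr
  have hr'r : r' ≤ r := by nlinarith
  have hr0 : 0 < r := hr'0.trans_le hr'r
  have hrρ : r ≤ ρ := by nlinarith
  have hδr : δ < 2 * r' := by
    calc δ = ‖(x - z) - (x₀ - z)‖ := by rw [hδ]; congr 1; abel
      _ ≤ ‖x - z‖ + ‖x₀ - z‖ := norm_sub_le _ _
      _ < 2 * r' := by linarith
  have hup : ∀ τ : ℝ, 0 ≤ τ → τ ≤ (G + 2) * δ → x + τ • e ∈ ball z r := by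
    intro τ h0 h1
    rw [mem_ball_iff_norm, add_sub_right_comm]
    calc ‖x - z + τ • e‖ ≤ ‖x - z‖ + ‖τ • e‖ := norm_add_le _ _
      _ < r' + (G + 2) * (2 * r') := by
          rw [norm_smul, he, mul_one, Real.norm_of_nonneg h0]
          have : (G + 2) * δ ≤ (G + 2) * (2 * r') := by gcongr
          linarith
      _ ≤ r := by linarith
  obtain ⟨t, ht0, ht⟩ := hexit x (by rw [mem_ball_iff_norm]; linarith) hx
  -- The cone above `x₀` already contains `x + (G+1)δ • e`, so the vertical line has entered `Ω` by
  -- then.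
  have htle : t ≤ (G + 1) * δ := by
    have hb := hup ((G + 1) * δ) (by positivity) (by nlinarith)
    have hb' := ball_subset_ball hrρ hb
    have := hcone x₀ (by rw [mem_ball_iff_norm]; linarith) hx₀ (x - x₀) ((G + 1) * δ) le_rfl
    rw [add_sub_cancel] at this
    exact ((ht _ hb').1 (this hb')).le
  set φ : ℝ → ℝ := fun η => d (x + (t + η) • e) with hφ
  have hl : ∀ η : ℝ, HasDerivAt (fun η : ℝ => x + (t + η) • e) e η := fun η => by
    simpa using (((hasDerivAt_id η).const_add t).smul_const e).const_add x
  have hφc : Continuous φ := hdc.comp (by fun_prop)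
  have hφ0 : φ 0 = 0 := by
    simp only [hφ, add_zero]
    refine hd0 _ fun h => ?_
    exact lt_irrefl t ((ht t (ball_subset_ball hrρ (hup t ht0 (by nlinarith)))).1 h)
  have hδpow : 0 < δ ^ (1 + α) := by positivity
  -- By continuity `d` is negligible just above the entry point; this is the summand `1` of the
  -- constant.
  obtain ⟨η₀, hη₀, hη₀δ, hsmall⟩ : ∃ η₀ > 0, η₀ ≤ δ ∧ ∀ η ∈ Ioo 0 η₀, φ η ≤ δ ^ (1 + α) := by
    have hev : ∀ᶠ η in 𝓝 (0 : ℝ), φ η < δ ^ (1 + α) :=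
      hφc.continuousAt.eventually_lt continuousAt_const (by rw [hφ0]; exact hδpow)
    obtain ⟨ε, hε, hball⟩ := Metric.eventually_nhds_iff.1 hev
    refine ⟨min ε δ, lt_min hε hδ0, min_le_right _ _, fun η hη => (hball ?_).le⟩
    rw [Real.dist_eq, sub_zero, abs_of_pos hη.1]
    exact hη.2.trans_le (min_le_left _ _)
  have hmem : ∀ η ∈ Ioc 0 η₀, x + (t + η) • e ∈ ball z r ∧ x + (t + η) • e ∈ Ω := by
    intro η hη
    have hb := hup (t + η) (by linarith [hη.1]) (by linarith [hη.2])
    exact ⟨hb, (ht _ (ball_subset_ball hrρ hb)).2 (by linarith [hη.1])⟩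
  -- Since `φ` rises from zero to a positive value, the vertical derivative is positive at some `p`.
  -- Hölder continuity then makes it nearly nonnegative at `x₀`, so descending from `p` to `x`
  -- raises the Taylor polynomial by at most `O(δ^(1+α))`.
  obtain ⟨c, hc, hslope⟩ := exists_hasDerivAt_eq_slope φ
    (fun η => fderiv ℝ d (x + (t + η) • e) e) hη₀ hφc.continuousOn fun η hη =>
      (hd _ (hmem η ⟨hη.1, hη.2.le⟩).2).hasFDerivAt.comp_hasDerivAt η (hl η)
  have hcI : c ∈ Ioc 0 η₀ := ⟨hc.1, hc.2.le⟩
  set p := x + (t + c) • e with hp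
  obtain ⟨hpr, hpΩ⟩ := hmem c hcI
  have hpos : 0 < fderiv ℝ d p e := by
    rw [hslope, hφ0, sub_zero, sub_zero]
    exact div_pos (hdpos _ (hmem η₀ ⟨hη₀, le_rfl⟩).2) hη₀
  have htc0 : 0 ≤ t + c := by linarith [hc.1]
  have htc : t + c ≤ (G + 2) * δ := by linarith [hc.2]
  have hpx₀ : ‖p - x₀‖ ≤ (G + 3) * δ := by
    rw [hp, add_sub_right_comm]
    refine (norm_add_le _ _).trans ?_
    rw [norm_smul, he, mul_one, Real.norm_of_nonneg htc0, ← hδ]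
    linarith
  have hA := abs_taylor_le_of_cone hα hK0 hd hK he hG hcone hr hx₀ hpΩ
    (ball_subset_ball hr'r (mem_ball_iff_norm.2 hx₀r)) hpr
  rw [← hC₁] at hA
  have hpow1 : ‖p - x₀‖ ^ (1 + α) ≤ (G + 3) ^ (1 + α) * δ ^ (1 + α) := by
    rw [← Real.mul_rpow (by positivity) hδ0.le]
    exact Real.rpow_le_rpow (norm_nonneg _) hpx₀ (by linarith)
  have hpow2 : ‖p - x₀‖ ^ α ≤ (G + 3) ^ α * δ ^ α := by
    rw [← Real.mul_rpow (by positivity) hδ0.le]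
    exact Real.rpow_le_rpow (norm_nonneg _) hpx₀ hα.le
  have hLe : -(K * ((G + 3) ^ α * δ ^ α)) ≤ fderiv ℝ d x₀ e := by
    have h1 := (fderiv ℝ d p - fderiv ℝ d x₀).le_opNorm e
    rw [he, mul_one, Real.norm_eq_abs, sub_apply] at h1
    have h2 := (hK p hpΩ x₀ hx₀).trans (mul_le_mul_of_nonneg_left hpow2 hK0)
    have h3 := le_abs_self (fderiv ℝ d p e - fderiv ℝ d x₀ e)
    linarith
  have hdp : d p ≤ δ ^ (1 + α) := hsmall c hc
  have hlin : fderiv ℝ d x₀ (p - x₀) = fderiv ℝ d x₀ (x - x₀) + (t + c) * fderiv ℝ d x₀ e := by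
    rw [hp, add_sub_right_comm, map_add, map_smul, smul_eq_mul]
  have h6 : -((t + c) * fderiv ℝ d x₀ e) ≤ (G + 2) * δ * (K * ((G + 3) ^ α * δ ^ α)) := by
    have hnn : 0 ≤ K * ((G + 3) ^ α * δ ^ α) := by positivity
    calc -((t + c) * fderiv ℝ d x₀ e) = (t + c) * (-fderiv ℝ d x₀ e) := by ring
      _ ≤ (t + c) * (K * ((G + 3) ^ α * δ ^ α)) :=
          mul_le_mul_of_nonneg_left (by linarith) htc0
      _ ≤ _ := mul_le_mul_of_nonneg_right htc hnn
  have h7 : C₁ * ‖p - x₀‖ ^ (1 + α) ≤ C₁ * ((G + 3) ^ (1 + α) * δ ^ (1 + α)) :=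
    mul_le_mul_of_nonneg_left hpow1 hC₁0
  have h8 : δ ^ (1 + α) = δ * δ ^ α := by rw [Real.rpow_one_add' hδ0.le (by linarith)]
  have h9 := (abs_le.1 hA).1
  have h10 : (G + 2) * δ * (K * ((G + 3) ^ α * δ ^ α)) =
      (G + 2) * (K * (G + 3) ^ α) * δ ^ (1 + α) := by rw [h8]; ring
  rw [hlin] at h9
  linarith

end Taylor

/-- The uniform Taylor estimate for a distance function of a `C^{1,α}` domain. -/
lemma IsDistanceFunction.exists_hasTaylorBound {n : ℕ} {α : ℝ}
    {Ω : Set (EuclideanSpace ℝ (Fin n))} {d : EuclideanSpace ℝ (Fin n) → ℝ}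
    (h : IsDistanceFunction α Ω d) (hα : 0 < α) (hΩ : IsC1HolderDomain α Ω)
    (hb : Bornology.IsBounded Ω) :
    ∃ r : ℝ, 0 < r ∧ ∃ C : ℝ, 0 < C ∧
      ∀ x₀ ∈ Ω, ∀ x, ‖x - x₀‖ < r → HasTaylorBound Ω d α C x₀ x := by
  obtain ⟨K, hK0, hK⟩ := h.isC1Holder.exists_nonneg
  have hd := h.isC1Holder.1
  have local_bound : ∀ z ∈ closure Ω, ∃ r : ℝ, 0 < r ∧ ∃ C : ℝ, 0 < C ∧
      ∀ x₀ ∈ Ω, x₀ ∈ ball z r → ∀ x ∈ ball z r, HasTaylorBound Ω d α C x₀ x := by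
    intro z hz
    by_cases hzΩ : z ∈ Ω
    · obtain ⟨r, hr, hball⟩ := Metric.isOpen_iff.1 hΩ.1 z hzΩ
      refine ⟨r, hr, K + 1, by positivity, fun x₀ _ hx₀r x hxr => ⟨fun _ => ?_, fun hx =>
        absurd (hball hxr) hx⟩⟩
      have hseg := ((convex_ball z r).segment_subset hx₀r hxr).trans hball
      have := abs_sub_sub_fderiv_le_of_segment hd hK0 hα.le hK (hball hx₀r) hseg
        (D := ‖x - x₀‖) (by simp) le_rfl
      rw [← sub_sub]
      refine this.trans ?_
      rw [Real.rpow_one_add' (norm_nonneg _) (by linarith)]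
      have hp : 0 ≤ ‖x - x₀‖ * ‖x - x₀‖ ^ α := by positivity
      linarith
    · have hzf : z ∈ frontier Ω := ⟨hz, by rwa [hΩ.1.interior_eq]⟩
      obtain ⟨ρ, hρ, e, he, G, hG, hcone, hexit⟩ := hΩ.exists_cone hα.le hzf
      have hG5 : 0 < 2 * G + 5 := by linarith
      have hr : ρ / (2 * G + 5) * (2 * G + 5) ≤ ρ := (div_mul_cancel₀ _ hG5.ne').le
      have hr' : ρ / (2 * G + 5) / (2 * G + 5) * (2 * G + 5) ≤ ρ / (2 * G + 5) :=
        (div_mul_cancel₀ _ hG5.ne').le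
      refine ⟨ρ / (2 * G + 5) / (2 * G + 5), by positivity,
        max (K * (G + 2) ^ α * (2 * G + 3)) (1 + K * (G + 2) ^ α * (2 * G + 3) * (G + 3) ^ (1 + α)
          + (G + 2) * (K * (G + 3) ^ α)), lt_max_of_lt_right (by positivity),
        fun x₀ hx₀ hx₀r x hxr => ⟨fun hx => ?_, fun hx => ?_⟩⟩
      · have hsub : ball z (ρ / (2 * G + 5) / (2 * G + 5)) ⊆ ball z (ρ / (2 * G + 5)) :=
          ball_subset_ball (div_le_self (by positivity) (by linarith))
        refine (abs_taylor_le_of_cone hα hK0 hd hK he hG hcone hr hx₀ hx (hsub hx₀r)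
          (hsub hxr)).trans ?_
        exact mul_le_mul_of_nonneg_right (le_max_left _ _) (Real.rpow_nonneg (norm_nonneg _) _)
      · refine (taylor_le_of_cone hα hK0 hd (h.continuous hΩ.1) h.pos h.eq_zero hK he hG hcone
          hexit hr hr' hx₀ hx hx₀r hxr).trans ?_
        exact mul_le_mul_of_nonneg_right (le_max_right _ _) (Real.rpow_nonneg (norm_nonneg _) _)
  -- Compactness of `closure Ω` makes the local constants uniform; halving the radius lets `x` range
  -- over a ball about `x₀`.
  have key : ∃ r : ℝ, 0 < r ∧ ∃ C : ℝ, 0 < C ∧ ∀ x₀ ∈ closure Ω, x₀ ∈ Ω → ∀ x, ‖x - x₀‖ < r →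
      HasTaylorBound Ω d α C x₀ x := by
    refine hb.isCompact_closure.induction_on (p := fun S => ∃ r : ℝ, 0 < r ∧ ∃ C : ℝ, 0 < C ∧
      ∀ x₀ ∈ S, x₀ ∈ Ω → ∀ x, ‖x - x₀‖ < r → HasTaylorBound Ω d α C x₀ x) ?_ ?_ ?_ ?_
    · exact ⟨1, one_pos, 1, one_pos, by simp⟩
    · rintro S T hST ⟨r, hr, C, hC, hT⟩
      exact ⟨r, hr, C, hC, fun x₀ hx₀ => hT x₀ (hST hx₀)⟩
    · rintro S T ⟨r, hr, C, hC, hS⟩ ⟨r', hr', C', hC', hT⟩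
      refine ⟨min r r', lt_min hr hr', max C C', lt_max_of_lt_left hC, ?_⟩
      rintro x₀ (hx₀ | hx₀) hx₀Ω x hx
      · exact (hS x₀ hx₀ hx₀Ω x (hx.trans_le (min_le_left _ _))).mono (le_max_left _ _)
      · exact (hT x₀ hx₀ hx₀Ω x (hx.trans_le (min_le_right _ _))).mono (le_max_right _ _)
    · intro z hz
      obtain ⟨r, hr, C, hC, hT⟩ := local_bound z hz
      refine ⟨ball z (r / 2), mem_nhdsWithin_of_mem_nhds (ball_mem_nhds z (by positivity)),
        r / 2, by positivity, C, hC, fun x₀ hx₀ hx₀Ω x hx => hT x₀ hx₀Ω ?_ x ?_⟩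
      · exact ball_subset_ball (by linarith) hx₀
      · rw [mem_ball_iff_norm] at hx₀ ⊢
        calc ‖x - z‖ = ‖(x - x₀) + (x₀ - z)‖ := by congr 1; abel
          _ ≤ ‖x - x₀‖ + ‖x₀ - z‖ := norm_add_le _ _
          _ < r := by linarith
  obtain ⟨r, hr, C, hC, hT⟩ := key
  exact ⟨r, hr, C, hC, fun x₀ hx₀ => hT x₀ (subset_closure hx₀) hx₀⟩

/-! ### The weighted bound on the remainder and the conclusion. -/

/-- Rescaling the Riesz vector `v` of `g` to `v/‖v‖²` supplies the transversal direction for the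
slab estimate. -/
lemma exists_norm_le_one_apply_eq_one {E : Type*} [NormedAddCommGroup E] [InnerProductSpace ℝ E]
    [CompleteSpace E] (g : E →L[ℝ] ℝ) (hg : 1 ≤ ‖g‖) : ∃ e : E, ‖e‖ ≤ 1 ∧ g e = 1 := by
  set v := (InnerProductSpace.toDual ℝ E).symm g with hv
  have hvn : ‖v‖ = ‖g‖ := LinearIsometryEquiv.norm_map _ _
  have h0 : 0 < ‖v‖ := by linarith
  have hgv : g v = ‖v‖ ^ 2 := by
    rw [← real_inner_self_eq_norm_sq, hv, InnerProductSpace.toDual_symm_apply]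
  refine ⟨(‖v‖ ^ 2)⁻¹ • v, ?_, ?_⟩
  · rw [norm_smul, norm_inv, norm_pow, norm_norm, pow_two, mul_inv, mul_assoc,
      inv_mul_cancel₀ h0.ne', mul_one, hvn]
    exact inv_le_one_of_one_le₀ hg
  · rw [map_smul, hgv, smul_eq_mul, inv_mul_cancel₀ (by positivity)]

/-- Uniform decay at small scales of the integrals of `|c + g| ^ (s - 1)`, when either the slope
`g` or the value `c` is bounded below. -/
lemma lintegral_closedBall_affine_rpow_le_of_or {E : Type*} [NormedAddCommGroup E]
    [InnerProductSpace ℝ E] [MeasurableSpace E] [BorelSpace E] [FiniteDimensional ℝ E]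
    (μ : Measure E) [μ.IsAddHaarMeasure] {s : ℝ} (hs : s ∈ Ioo (0 : ℝ) 1) {M δ r₀ : ℝ}
    (hM : 0 ≤ M) (hδ : 0 < δ) (hr₀1 : r₀ ≤ 1) (hr₀ : M * r₀ ≤ δ / 2) {g : E →L[ℝ] ℝ}
    (hg : ‖g‖ ≤ M) {c : ℝ} (hc : 1 ≤ ‖g‖ ∨ δ ≤ c) {R : ℝ} (hR : R ∈ Ioc 0 r₀) :
    ∫⁻ y in closedBall 0 R, ENNReal.ofReal |c + g y| ^ (s - 1) ∂μ ≤
      (ENNReal.ofReal ((2 / s + 1) * 2 ^ Module.finrank ℝ E) * μ (closedBall 0 1) +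
        ENNReal.ofReal ((δ / 2) ^ (s - 1)) * μ (closedBall 0 1)) *
        ENNReal.ofReal (R ^ ((Module.finrank ℝ E : ℝ) + s - 1)) := by
  rw [add_mul]
  rcases hc with hc | hc
  · obtain ⟨e, he, hge⟩ := exists_norm_le_one_apply_eq_one g hc
    exact (lintegral_closedBall_affine_rpow_le μ hs g he hge c hR.1).trans le_self_add
  · refine le_trans ?_ le_add_self
    have hpt : ∀ y ∈ closedBall (0 : E) R,
        ENNReal.ofReal |c + g y| ^ (s - 1) ≤ ENNReal.ofReal ((δ / 2) ^ (s - 1)) := by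
      intro y hy
      rw [mem_closedBall_zero_iff] at hy
      have h1 : |g y| ≤ δ / 2 := by
        refine (g.le_opNorm y).trans (le_trans ?_ hr₀)
        exact mul_le_mul hg (hy.trans hR.2) (norm_nonneg _) hM
      have h2 : δ / 2 ≤ |c + g y| := by
        refine le_trans ?_ (le_abs_self _)
        linarith [(abs_le.1 h1).1]
      rw [ENNReal.ofReal_rpow_of_pos (by linarith)]
      exact ENNReal.ofReal_le_ofReal
        (Real.rpow_le_rpow_of_nonpos (by positivity) h2 (by linarith [hs.2]))
    refine (setLIntegral_mono' measurableSet_closedBall hpt).trans ?_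
    rw [setLIntegral_const, Measure.addHaar_closedBall' μ 0 hR.1.le, mul_assoc,
      mul_comm (ENNReal.ofReal (R ^ _))]
    gcongr
    rw [← Real.rpow_natCast]
    exact Real.rpow_le_rpow_of_exponent_ge hR.1 (hR.2.trans hr₀1) (by linarith [hs.2])

/-- Uniform weighted `L¹` estimate for the difference between `d ^ s` and the `s`-th power of the
positive part of the Taylor polynomial of `d`. -/
lemma IsDistanceFunction.exists_lintegral_le {n : ℕ} (hn : 1 ≤ n) {α s : ℝ}
    (hs : s ∈ Ioo (0 : ℝ) 1) (hsα : s < α) {Ω : Set (EuclideanSpace ℝ (Fin n))}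
    {d : EuclideanSpace ℝ (Fin n) → ℝ} (h : IsDistanceFunction α Ω d)
    (hΩ : IsC1HolderDomain α Ω) (hb : Bornology.IsBounded Ω) :
    ∃ T : ENNReal, T ≠ ⊤ ∧ ∀ x ∈ Ω, ∫⁻ y, ENNReal.ofReal (‖y‖ ^ (-((n : ℝ) + 2 * s)) *
      |d (x + y) ^ s - max (d x + fderiv ℝ d x y) 0 ^ s|) ≤ T := by
  have : Nontrivial (EuclideanSpace ℝ (Fin n)) :=
    Module.nontrivial_of_finrank_pos (R := ℝ) (by rw [finrank_euclideanSpace_fin]; omega)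
  have hα : 0 < α := hs.1.trans hsα
  obtain ⟨M, hM0, hM⟩ := h.isC1Holder.exists_norm_fderiv_le hα.le hb
  obtain ⟨B, hB0, hB⟩ := h.exists_le hΩ.1 hb
  obtain ⟨δ, hδ, hgrad⟩ := h.exists_one_le_norm_fderiv hΩ.1 hb
  obtain ⟨r₁, hr₁, C, hC, hT⟩ := h.exists_hasTaylorBound hα hΩ hb
  -- The three bounds serve, in order, the comparison `R^n ≤ R^(n+s-1)`, the Taylor estimate, and
  -- `|g y| ≤ δ/2`.
  set r₀ := min 1 (min (r₁ / 2) (δ / (2 * (M + 1)))) with hr₀def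
  have hr₀ : 0 < r₀ := by positivity
  have hr₀1 : r₀ ≤ 1 := min_le_left _ _
  have hr₀r : r₀ < r₁ :=
    (((min_le_right _ _).trans (min_le_left _ _)).trans_lt (half_lt_self hr₁))
  have hr₀M : M * r₀ ≤ δ / 2 := by
    have h1 : r₀ ≤ δ / (2 * (M + 1)) := (min_le_right _ _).trans (min_le_right _ _)
    rw [le_div_iff₀ (by positivity)] at h1
    nlinarith
  have hfin : Module.finrank ℝ (EuclideanSpace ℝ (Fin n)) = n := finrank_euclideanSpace_fin
  -- Kernel times Taylor error has order `-β`, the slab mass has order `γ`, and `β < γ` is precisely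
  -- `s < α`.
  obtain ⟨Q, hQ, hdy⟩ := exists_lintegral_closedBall_rpow_mul_le
    (volume : Measure (EuclideanSpace ℝ (Fin n))) (β := (n : ℝ) + 2 * s - 1 - α)
    (γ := (n : ℝ) + s - 1) (by linarith) hr₀
  have hfar := lintegral_compl_closedBall_lt_top
    (volume : Measure (EuclideanSpace ℝ (Fin n))) hs.1 hr₀
  have hslab := fun (g : EuclideanSpace ℝ (Fin n) →L[ℝ] ℝ) (hg : ‖g‖ ≤ M) (c : ℝ)
      (hc : 1 ≤ ‖g‖ ∨ δ ≤ c) (R : ℝ) (hR : R ∈ Ioc 0 r₀) =>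
    lintegral_closedBall_affine_rpow_le_of_or
      (volume : Measure (EuclideanSpace ℝ (Fin n))) hs hM0 hδ hr₀1 hr₀M hg hc hR
  rw [hfin] at hfar hslab
  set A : ENNReal := ENNReal.ofReal ((2 / s + 1) * 2 ^ n) *
      volume (closedBall (0 : EuclideanSpace ℝ (Fin n)) 1) + ENNReal.ofReal ((δ / 2) ^ (s - 1)) *
        volume (closedBall (0 : EuclideanSpace ℝ (Fin n)) 1) with hA
  have hAtop : A ≠ ⊤ := by
    have hv : volume (closedBall (0 : EuclideanSpace ℝ (Fin n)) 1) ≠ ⊤ :=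
      measure_closedBall_lt_top.ne
    exact ENNReal.add_ne_top.2 ⟨ENNReal.mul_ne_top ENNReal.ofReal_ne_top hv,
      ENNReal.mul_ne_top ENNReal.ofReal_ne_top hv⟩
  set F := ∫⁻ y in (closedBall (0 : EuclideanSpace ℝ (Fin n)) r₀)ᶜ, ENNReal.ofReal
      (‖y‖ ^ (-((n : ℝ) + 2 * s)) * (1 + ‖y‖) ^ s) with hF
  refine ⟨ENNReal.ofReal C * (A * Q) + ENNReal.ofReal (B ^ s + (B + M) ^ s) * F,
    ENNReal.add_ne_top.2 ⟨ENNReal.mul_ne_top ENNReal.ofReal_ne_top (ENNReal.mul_ne_top hAtop hQ),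
      ENNReal.mul_ne_top ENNReal.ofReal_ne_top hfar.ne⟩, fun x hx => ?_⟩
  set g := fderiv ℝ d x with hg
  rw [← lintegral_add_compl _ (measurableSet_closedBall (x := 0) (ε := r₀))]
  refine add_le_add ?_ ?_
  · have hnear := hdy (fun y => ENNReal.ofReal |d x + g y| ^ (s - 1)) A
      (hslab g (hM x hx) (d x) (by
        rcases lt_or_ge (d x) δ with h1 | h1
        · exact Or.inl (hgrad x hx h1)
        · exact Or.inr h1))
    refine le_trans ?_ (mul_le_mul_right hnear (ENNReal.ofReal C))
    rw [← lintegral_const_mul' _ _ ENNReal.ofReal_ne_top]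
    refine setLIntegral_mono' measurableSet_closedBall fun y hy => ?_
    rw [mem_closedBall_zero_iff] at hy
    rcases eq_or_ne y 0 with rfl | hy0
    · simp [max_eq_left (h.nonneg x)]
    have hyn : 0 < ‖y‖ := norm_pos_iff.2 hy0
    have ht := hT x hx (x + y) (by rw [add_sub_cancel_left]; exact hy.trans_lt hr₀r)
    rw [HasTaylorBound, add_sub_cancel_left, ← hg] at ht
    have hbd := ofReal_abs_rpow_sub_max_rpow_le hs (a := d (x + y)) (b := d x + g y)
      (ε := C * ‖y‖ ^ (1 + α)) (h.nonneg _) (by positivity) (by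
        by_cases hxy : x + y ∈ Ω
        · exact Or.inl (ht.1 hxy)
        · exact Or.inr ⟨h.eq_zero _ hxy, ht.2 hxy⟩)
    rw [ENNReal.ofReal_mul (by positivity)]
    refine (mul_le_mul_right hbd _).trans (le_of_eq ?_)
    rw [← mul_assoc, ← mul_assoc, ← ENNReal.ofReal_mul (by positivity),
      ← ENNReal.ofReal_mul hC.le, mul_left_comm, ← Real.rpow_add hyn]
    congr 4
    ring
  · rw [hF, ← lintegral_const_mul' _ _ ENNReal.ofReal_ne_top]
    refine setLIntegral_mono' measurableSet_closedBall.compl fun y _ => ?_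
    rw [← ENNReal.ofReal_mul (add_nonneg (Real.rpow_nonneg hB0 _)
      (Real.rpow_nonneg (add_nonneg hB0 hM0) _)), mul_left_comm]
    refine ENNReal.ofReal_le_ofReal (mul_le_mul_of_nonneg_left ?_
      (Real.rpow_nonneg (norm_nonneg _) _))
    have h0 : 0 ≤ max (d x + g y) 0 := le_max_right _ _
    have hnn : 0 ≤ ‖y‖ := norm_nonneg y
    have e1 : d (x + y) ^ s ≤ B ^ s := Real.rpow_le_rpow (h.nonneg _) (hB _) hs.1.le
    have e2 : max (d x + g y) 0 ^ s ≤ (B + M) ^ s * (1 + ‖y‖) ^ s := by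
      rw [← Real.mul_rpow (by positivity) (by positivity)]
      refine Real.rpow_le_rpow h0 (max_le ?_ (by positivity)) hs.1.le
      have h1 : g y ≤ M * ‖y‖ := (le_abs_self _).trans (g.le_of_opNorm_le (hM x hx) y)
      have h2 := hB x
      nlinarith [mul_nonneg hB0 hnn]
    have e3 : (1 : ℝ) ≤ (1 + ‖y‖) ^ s := Real.one_le_rpow (by linarith) hs.1.le
    have e4 : 0 ≤ d (x + y) ^ s := Real.rpow_nonneg (h.nonneg _) _
    have e5 : 0 ≤ max (d x + g y) 0 ^ s := Real.rpow_nonneg h0 _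
    have e6 : 0 ≤ B ^ s := Real.rpow_nonneg hB0 _
    rw [abs_le]
    constructor <;> nlinarith

/-- The kernel of a stable operator only sees the values of the density on the unit sphere, which
extend to a measurable function. -/
lemma IsEllipticDensity.exists_measurable {n : ℕ} {lam Lam : ℝ}
    {a : EuclideanSpace ℝ (Fin n) → ℝ} (ha : IsEllipticDensity lam Lam a) (hn : 1 ≤ n) {s : ℝ}
    (hs : 0 < s) (hlam : 0 < lam) :
    ∃ b : EuclideanSpace ℝ (Fin n) → ℝ, Measurable b ∧
      (∀ θ ∈ sphere (0 : EuclideanSpace ℝ (Fin n)) 1, |b θ| ≤ Lam) ∧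
      ∀ y, a (‖y‖⁻¹ • y) / ‖y‖ ^ ((n : ℝ) + 2 * s) = stableKernel s b y := by
  refine ⟨(sphere (0 : EuclideanSpace ℝ (Fin n)) 1).indicator a, ?_, ?_, ?_⟩
  · have hS : MeasurableSet (sphere (0 : EuclideanSpace ℝ (Fin n)) 1) :=
      isClosed_sphere.measurableSet
    have := (MeasurableEmbedding.subtype_coe hS).measurable_extend ha.1
      (g' := fun _ => (0 : ℝ)) measurable_const
    convert this using 1
    ext x
    by_cases hx : x ∈ sphere (0 : EuclideanSpace ℝ (Fin n)) 1
    · rw [indicator_of_mem hx]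
      exact (Subtype.val_injective.extend_apply ((sphere 0 1).domRestrict a) (fun _ => 0)
        (⟨x, hx⟩ : sphere (0 : EuclideanSpace ℝ (Fin n)) 1)).symm
    · rw [indicator_of_notMem hx, Function.extend_apply']
      rintro ⟨y, rfl⟩
      exact hx y.2
  · intro θ hθ
    rw [indicator_of_mem hθ, abs_of_nonneg (hlam.le.trans (ha.2 θ hθ).1)]
    exact (ha.2 θ hθ).2
  · intro y
    rw [stableKernel, finrank_euclideanSpace_fin]
    rcases eq_or_ne y 0 with rfl | hy
    -- At the origin both quotients have zero denominator, hence equal zero whatever the value of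
    -- `a` there.
    · have : (n : ℝ) + 2 * s ≠ 0 := by positivity
      simp [Real.zero_rpow this]
    · rw [indicator_of_mem]
      rw [mem_sphere_zero_iff_norm, norm_smul, norm_inv, norm_norm,
        inv_mul_cancel₀ (norm_ne_zero_iff.2 hy)]

lemma max_add_rpow_eq {s ρ t : ℝ} (hρ : 0 < ρ) :
    max (ρ + t) 0 ^ s = ρ ^ s * max (1 + ρ⁻¹ * t) 0 ^ s := by
  rw [← Real.mul_rpow hρ.le (le_max_right _ _), mul_max_of_nonneg _ _ hρ.le, mul_zero, mul_add,
    mul_one, mul_inv_cancel_left₀ (ne_of_gt hρ)]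

/-- A weighted `L¹` bound on the difference between `u` and the `s`-th power of the positive part of
an affine function controls the stable operator applied to `u`. -/
lemma abs_stableOperator_le_of_lintegral_le {n : ℕ} (hn : 1 ≤ n) {s : ℝ} (hs : s ∈ Ioo (0 : ℝ) 1)
    {u : EuclideanSpace ℝ (Fin n) → ℝ} (hu : Measurable u) {x : EuclideanSpace ℝ (Fin n)} {ρ : ℝ}
    (hρ : 0 < ρ) (hux : u x = ρ ^ s) (g : EuclideanSpace ℝ (Fin n) →L[ℝ] ℝ) {T : ENNReal}
    (hT : T ≠ ⊤) (hle : ∫⁻ y, ENNReal.ofReal (‖y‖ ^ (-((n : ℝ) + 2 * s)) *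
      |u (x + y) - max (ρ + g y) 0 ^ s|) ≤ T) {lam Lam : ℝ} (hlam : 0 < lam)
    {a : EuclideanSpace ℝ (Fin n) → ℝ} (ha : IsEllipticDensity lam Lam a) :
    Integrable (stableIntegrand s a u x) ∧ |stableOperator s a u x| ≤ Lam * T.toReal := by
  have hnt : Nontrivial (EuclideanSpace ℝ (Fin n)) :=
    Module.nontrivial_of_finrank_pos (R := ℝ) (by rw [finrank_euclideanSpace_fin]; omega)
  obtain ⟨b, hbm, hbL, hker⟩ := ha.exists_measurable hn hs.1 hlam
  have hL : 0 ≤ Lam := by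
    obtain ⟨v, hv⟩ := exists_norm_eq (EuclideanSpace ℝ (Fin n)) (zero_le_one' ℝ)
    exact (abs_nonneg _).trans (hbL v (by simpa using hv))
  set F : EuclideanSpace ℝ (Fin n) → ℝ := fun y => u (x + y) - max (ρ + g y) 0 ^ s with hF
  set Φ : EuclideanSpace ℝ (Fin n) → ℝ := fun y => ‖y‖ ^ (-((n : ℝ) + 2 * s)) * |F y| with hΦ
  have hFm : Measurable F := by
    have h1 : Measurable fun y => u (x + y) := hu.comp (measurable_const_add x)
    have h2 : Measurable fun y => max (ρ + g y) 0 ^ s :=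
      ((g.continuous.measurable.const_add ρ).max measurable_const).pow_const s
    exact h1.sub h2
  have hΦm : Measurable Φ := (measurable_norm.pow_const _).mul hFm.norm
  have hΦ0 : ∀ y, 0 ≤ Φ y := fun y => by positivity
  have hΦi : Integrable Φ := by
    refine ⟨hΦm.aestronglyMeasurable, ?_⟩
    rw [hasFiniteIntegral_iff_ofReal (Filter.Eventually.of_forall hΦ0)]
    exact hle.trans_lt hT.lt_top
  have hΦT : ∫ y, Φ y ≤ T.toReal := by
    rw [integral_eq_lintegral_of_nonneg_ae (Filter.Eventually.of_forall hΦ0)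
      hΦm.aestronglyMeasurable]
    exact ENNReal.toReal_mono hT hle
  have hΦneg : Integrable fun y => Φ (-y) := hΦi.comp_neg
  -- The integrand is `w` plus `ρ^s` times the second difference of the frozen profile, which
  -- integrates to zero. No centre term appears because `u x = ρ^s`.
  set w : EuclideanSpace ℝ (Fin n) → ℝ := fun y => (F y + F (-y)) / 2 * stableKernel s b y with hw
  have hwm : Measurable w :=
    ((hFm.add (hFm.comp measurable_neg)).div_const 2).mul (measurable_stableKernel s hbm)
  have hwle : ∀ᵐ y, ‖w y‖ ≤ Lam * ((Φ y + Φ (-y)) / 2) := by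
    filter_upwards [Measure.ae_ne volume (0 : EuclideanSpace ℝ (Fin n))] with y hy
    have hk := abs_stableKernel_le s hbL hy
    rw [finrank_euclideanSpace_fin] at hk
    rw [hw, norm_mul, Real.norm_eq_abs, Real.norm_eq_abs, abs_div, abs_two]
    calc |F y + F (-y)| / 2 * |stableKernel s b y|
        ≤ (|F y| + |F (-y)|) / 2 * (Lam * ‖y‖ ^ (-((n : ℝ) + 2 * s))) := by
          gcongr
          exact abs_add_le _ _
      _ = _ := by simp only [hΦ, norm_neg]; ring
  have hdom : Integrable fun y => Lam * ((Φ y + Φ (-y)) / 2) :=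
    ((hΦi.add hΦneg).div_const 2).const_mul Lam
  have hwi : Integrable w := hdom.mono' hwm.aestronglyMeasurable hwle
  have hwint : |∫ y, w y| ≤ Lam * T.toReal := by
    rw [← Real.norm_eq_abs]
    refine (norm_integral_le_of_norm_le hdom hwle).trans ?_
    rw [integral_const_mul, integral_div, integral_add hΦi hΦneg, integral_neg_eq_self Φ,
      add_self_div_two]
    exact mul_le_mul_of_nonneg_left hΦT hL
  have hflat := (integrable_halfLineDiff_mul_stableKernel volume hs hbm hbL (ρ⁻¹ • g)).const_mul
    (ρ ^ s)
  have hzero := integral_halfLineDiff_mul_stableKernel volume hs hbm hbL (ρ⁻¹ • g)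
  have heq : stableIntegrand s a u x = fun y =>
      w y + ρ ^ s * (halfLineDiff s ((ρ⁻¹ • g) y) * stableKernel s b y) := by
    ext y
    have h1 := max_add_rpow_eq (s := s) (t := g y) hρ
    have h2 := max_add_rpow_eq (s := s) (t := -g y) hρ
    rw [mul_neg, ← sub_eq_add_neg 1] at h2
    simp only [stableIntegrand, hker, hw, hF, halfLineDiff, hux, map_neg, ← sub_eq_add_neg x,
      _root_.smul_apply, smul_eq_mul, h1, h2]
    ring
  refine ⟨heq ▸ hwi.add hflat, ?_⟩
  rw [stableOperator, heq, integral_add hwi hflat, integral_const_mul, hzero, mul_zero, add_zero]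
  exact hwint

theorem proposition2p5 (n : ℕ) (hn : 1 ≤ n) (s : ℝ) (hs : s ∈ Ioo (0 : ℝ) 1)
    (lam Lam : ℝ) (hlam : 0 < lam)
    (Ω : Set (EuclideanSpace ℝ (Fin n))) (hΩ : Bornology.IsBounded Ω)
    (d : EuclideanSpace ℝ (Fin n) → ℝ) :
    ∃ C : ℝ, ∀ α : ℝ, s < α → α ≤ 1 →
      IsC1HolderDomain α Ω → IsDistanceFunction α Ω d →
        ∀ a : EuclideanSpace ℝ (Fin n) → ℝ, IsEllipticDensity lam Lam a →
          ∀ x ∈ Ω, Integrable (stableIntegrand s a (fun z => d z ^ s) x) ∧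
            |stableOperator s a (fun z => d z ^ s) x| ≤ C := by
  -- The constant must not depend on `α`: any one admissible exponent yields a bound serving all of
  -- them, and if none exists the claim is vacuous.
  by_cases hex : ∃ α : ℝ, s < α ∧ IsC1HolderDomain α Ω ∧ IsDistanceFunction α Ω d
  · obtain ⟨α, hsα, hdom, hd⟩ := hex
    obtain ⟨T, hT, hle⟩ := hd.exists_lintegral_le hn hs hsα hdom hΩ
    refine ⟨Lam * T.toReal, fun _ _ _ _ _ a ha x hx => ?_⟩
    exact abs_stableOperator_le_of_lintegral_le hn hs
      ((hd.continuous hdom.1).measurable.pow_const s) (hd.pos x hx) rfl (fderiv ℝ d x) hT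
      (hle x hx) hlam ha
  · exact ⟨0, fun α hsα _ hdom hd => absurd ⟨α, hsα, hdom, hd⟩ hex⟩
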